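/- Let $p\in(1,\infty)$. There is a constant $C_p>0$, depending only on $p$, such that the following holds. Let $(X,\mathcal B(X),\mu)$ be a $\sigma$-finite measure space, let $(\mathcal F_n)_{n\in\mathbb Z}$ be a filtration, that is, an increasing family of sub-$\sigma$-algebras of $\mathcal B(X)$ such that $\mu$ is $\sigma$-finite on each $\mathcal F_n$, and let $\mathfrak f=(\mathfrak f_n)_{n\in\mathbb Z}$ be a complex-valued martingale with respect to $(\mathcal F_n)_{n\in\mathbb Z}$, that is, $\mathfrak f_n\in L^1(X,\mu)$ and $\mathfrak f_m=\mathbb E[\mathfrak f_n\mid\mathcal F_m]$ for all $m\le n$. Suppose that $\mathfrak f_n\in L^p(X,\mu)$ for all $n$ and $\sup_{n\in\mathbb Z}\|\mathfrak f_n\|_{L^p(X)}<\infty$. Then $$\sup_{N\ge 1}\ \sup_{I\in\mathfrak S_N(\mathbb Z)}\big\|O^2_{I,N}(\mathfrak f_n:n\in\mathbb Z)\big\|_{L^p(X)}\le C_p\sup_{n\in\mathbb Z}\|\mathfrak f_n\|_{L^p(X)},$$ where $\mathfrak S_N(\mathbb Z)$ is the set of all integer sequences $I=(I_0<I_1<\dots<I_N)$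 and $$O^2_{I,N}(\mathfrak f_n:n\in\mathbb Z)(x)=\Big(\sum_{j=0}^{N-1}\ \sup_{\substack{n\in\mathbb Z\\ I_j\le n<I_{j+1}}}|\mathfrak f_n(x)-\mathfrak f_{I_j}(x)|^2\Big)^{1/2}.$$ -/

import Mathlib

open MeasureTheory
open scoped ENNReal NNReal

/-- The strictly increasing sequences `I 0 < I 1 < ⋯ < I J` of length `J + 1` in `ι`. -/
def strictIncSeqs (J : ℕ) (ι : Type*) [LinearOrder ι] : Set (Fin (J + 1) → ι) :=
  {I | StrictMono I}

/-- The `r`-oscillation of the family `a` along the sequence `I`,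
`(∑_{j < J} sup_{I j ≤ t < I (j + 1)} |a t - a (I j)| ^ r) ^ (1 / r)`,
with values in `[0, ∞]`. -/
noncomputable def seqOscillation {ι : Type*} [LinearOrder ι] (r : ℝ) {J : ℕ}
    (I : Fin (J + 1) → ι) (a : ι → ℂ) : ℝ≥0∞ :=
  (∑ j : Fin J, ⨆ t ∈ Set.Ico (I j.castSucc) (I j.succ),
    ‖a t - a (I j.castSucc)‖ₑ ^ r) ^ (1 / r)

universe u v

/-! For p = 2, Doob's L² inequality bounds the maximal increment B_j on block j by four times the
square norm of the increment over the whole block, and orthogonality makes these norms telescope.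
For other p the same L² computation is run with a weight. Write Y_n for the running maximum of the
norms and O_n for the sum of B_j² over the first n blocks.

If p ≤ 2, the weight is Y^(p-2), which decreases in time. Each place where its variation enters
costs a multiple of an increment of Y^p, so the errors telescope too
(`integral_rpow_mul_incrMax_sq_le`). Removing the weight pointwise bounds ∫ O^(p/2) by a multiple of
∫ Y^p.

If p > 2, put q = p/2. By convexity O_N^q is controlled by the sum of O_j^(q-1) B_j² and a term of
lower order in O_N. The weight O_j^(q-1) is known when block j begins and increases with j, so
summation by parts leaves only the final term (`sum_integral_oscSq_rpow_mul_le`). Young's inequality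
absorbs the powers of O_N.

In both ranges Doob's L^p inequality replaces Y by the last martingale value. The Doob inequalities
come from one-step pointwise inequalities and the submartingale property of the norm, without
stopping times. -/

theorem inner_unit_sub_le {E : Type*} [NormedAddCommGroup E] [InnerProductSpace ℝ E]
    (u v : E) : inner ℝ (‖u‖⁻¹ • u) (v - u) ≤ ‖v‖ - ‖u‖ := by
  rcases eq_or_ne u 0 with rfl | hu
  · simp
  · have hu' : 0 < ‖u‖ := norm_pos_iff.2 hu
    rw [inner_sub_right, real_inner_smul_left, real_inner_smul_left, real_inner_self_eq_norm_sq]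
    have : inner ℝ u v ≤ ‖u‖ * ‖v‖ := real_inner_le_norm u v
    have h1 : ‖u‖⁻¹ * inner ℝ u v ≤ ‖u‖⁻¹ * (‖u‖ * ‖v‖) := by gcongr
    have h2 : ‖u‖⁻¹ * (‖u‖ * ‖v‖) = ‖v‖ := by field_simp
    have h3 : ‖u‖⁻¹ * ‖u‖ ^ 2 = ‖u‖ := by field_simp
    linarith

/-! ### Martingale increments: orthogonality and the submartingale property of the norm -/

section Martingale

variable {X E : Type*} {mX : MeasurableSpace X} {μ : Measure X}
  [NormedAddCommGroup E] [InnerProductSpace ℝ E] [CompleteSpace E]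

/-- The filtration obtained from `ℱ` by restricting the time along a monotone map `e`. -/
def reindexFiltration {ι κ : Type*} [Preorder ι] [Preorder κ] (ℱ : Filtration ι mX) (e : κ → ι)
    (he : Monotone e) : Filtration κ mX where
  seq k := ℱ (e k)
  mono' _ _ h := ℱ.mono (he h)
  le' k := ℱ.le (e k)

theorem sigmaFiniteFiltration_reindex {ι κ : Type*} [Preorder ι] [Preorder κ]
    (ℱ : Filtration ι mX) [SigmaFiniteFiltration μ ℱ] (e : κ → ι) (he : Monotone e) :
    SigmaFiniteFiltration μ (reindexFiltration ℱ e he) :=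
  ⟨fun k => inferInstanceAs (SigmaFinite (μ.trim (ℱ.le (e k))))⟩

theorem martingale_reindex {F ι κ : Type*} [NormedAddCommGroup F] [NormedSpace ℝ F]
    [CompleteSpace F] [Preorder ι] [Preorder κ]
    {ℱ : Filtration ι mX} {f : ι → X → F} (hf : Martingale f ℱ μ) (e : κ → ι) (he : Monotone e) :
    Martingale (fun k => f (e k)) (reindexFiltration ℱ e he) μ :=
  ⟨fun k => hf.1 (e k), fun i j hij => hf.2 (e i) (e j) (he hij)⟩

/-- The increments of a martingale after time `a` form a martingale. -/
theorem martingale_increment {ℱ : Filtration ℕ mX} [SigmaFiniteFiltration μ ℱ] {f : ℕ → X → E}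
    (hf : Martingale f ℱ μ) (a : ℕ) :
    Martingale (fun k x => f (a + k) x - f a x)
      (reindexFiltration ℱ (fun k => a + k) (fun _ _ h => Nat.add_le_add_left h a)) μ := by
  have he : Monotone (fun k : ℕ => a + k) := fun _ _ h => Nat.add_le_add_left h a
  have := sigmaFiniteFiltration_reindex (μ := μ) ℱ _ he
  exact (martingale_reindex hf _ he).sub (martingale_const_fun _ μ (hf.1 a) (hf.integrable a))

/-- Increments of a martingale after time `i` are orthogonal to `ℱ i`-measurable functions. -/
theorem integral_inner_martingale_sub {ι : Type*} [Preorder ι] {ℱ : Filtration ι mX}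
    [SigmaFiniteFiltration μ ℱ] {f : ι → X → E} (hf : Martingale f ℱ μ) {i j : ι} (hij : i ≤ j)
    {ψ : X → E} (hψ : StronglyMeasurable[ℱ i] ψ)
    (hint : Integrable (fun x => inner ℝ (ψ x) (f j x - f i x)) μ) :
    ∫ x, inner ℝ (ψ x) (f j x - f i x) ∂μ = 0 := by
  have hg : Integrable (f j - f i) μ := (hf.integrable j).sub (hf.integrable i)
  have h1 := condExp_bilin_of_stronglyMeasurable_left (innerSL ℝ) (m := ℱ i) (μ := μ) (g := f j - f i)
    hψ hint hg
  have h2 : μ[f j - f i | ℱ i] =ᵐ[μ] 0 := by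
    have h3 := condExp_sub (hf.integrable j) (hf.integrable i) (ℱ i)
    have h4 := condExp_of_stronglyMeasurable (ℱ.le i) (hf.1 i) (hf.integrable i)
    filter_upwards [h3, hf.2 i j hij] with x hx hx'
    simp [hx, hx', h4]
  rw [← integral_condExp (ℱ.le i)]
  refine integral_eq_zero_of_ae ?_
  filter_upwards [h1, h2] with x hx hx'
  have : (μ[fun x => inner ℝ (ψ x) (f j x - f i x) | ℱ i]) x
      = innerSL ℝ (ψ x) (μ[f j - f i | ℱ i] x) := hx
  rw [this, hx']
  simp

/-- The norm of a martingale is a submartingale, tested against unbounded weights. -/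
theorem integral_mul_norm_le {ι : Type*} [Preorder ι] {ℱ : Filtration ι mX}
    [SigmaFiniteFiltration μ ℱ] {f : ι → X → E} (hf : Martingale f ℱ μ) {i j : ι} (hij : i ≤ j)
    {φ : X → ℝ} (hφ : StronglyMeasurable[ℱ i] φ) (hφ0 : ∀ x, 0 ≤ φ x)
    (hi : Integrable (fun x => φ x * ‖f i x‖) μ) (hj : Integrable (fun x => φ x * ‖f j x‖) μ) :
    ∫ x, φ x * ‖f i x‖ ∂μ ≤ ∫ x, φ x * ‖f j x‖ ∂μ := by
  -- The field f_i/‖f_i‖ is a subgradient of the norm at f_i, so testing the increment against φ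
  -- times it bounds the gain in norm from below. Where f_i = 0 the convention 0⁻¹ = 0 gives the
  -- zero vector, still a subgradient.
  set ψ : X → E := fun x => φ x • (‖f i x‖⁻¹ • f i x) with hψ_def
  have hψ : StronglyMeasurable[ℱ i] ψ := by
    have h1 : StronglyMeasurable[ℱ i] (fun x => ‖f i x‖⁻¹) :=
      (hf.1 i).norm.measurable.inv.stronglyMeasurable
    exact hφ.smul (h1.smul (hf.1 i))
  have hψn : ∀ x, ‖ψ x‖ ≤ φ x := by
    intro x
    simp only [hψ_def, norm_smul, norm_inv, norm_norm, Real.norm_of_nonneg (hφ0 x)]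
    refine mul_le_of_le_one_right (hφ0 x) ?_
    exact inv_mul_le_one
  have hint : Integrable (fun x => inner ℝ (ψ x) (f j x - f i x)) μ := by
    refine (hi.add hj).mono' ?_ (Filter.Eventually.of_forall fun x => ?_)
    · exact (hψ.mono (ℱ.le i)).aestronglyMeasurable.inner
        ((hf.integrable j).sub (hf.integrable i)).aestronglyMeasurable
    · calc ‖inner ℝ (ψ x) (f j x - f i x)‖ ≤ ‖ψ x‖ * ‖f j x - f i x‖ := norm_inner_le_norm _ _
        _ ≤ φ x * (‖f i x‖ + ‖f j x‖) := by
          gcongr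
          · exact hφ0 x
          · exact hψn x
          · rw [add_comm]; exact norm_sub_le _ _
        _ = _ := by simp [mul_add]
  have h0 := integral_inner_martingale_sub hf hij hψ hint
  have h1 : ∫ x, inner ℝ (ψ x) (f j x - f i x) ∂μ ≤ ∫ x, (φ x * ‖f j x‖ - φ x * ‖f i x‖) ∂μ := by
    refine integral_mono hint (hj.sub hi) fun x => ?_
    simp only [hψ_def]
    rw [real_inner_smul_left, ← mul_sub]
    exact mul_le_mul_of_nonneg_left (inner_unit_sub_le _ _) (hφ0 x)
  rw [integral_sub hj hi] at h1
  linarith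

end Martingale

/-! ### Running maxima -/

section RunningMax

variable {X E : Type*} {mX : MeasurableSpace X} [NormedAddCommGroup E]

/-- The running maximum of the norms of a sequence of functions. -/
def runningMax (f : ℕ → X → E) (n : ℕ) (x : X) : ℝ := partialSups (fun k => ‖f k x‖) n

theorem runningMax_zero (f : ℕ → X → E) (x : X) : runningMax f 0 x = ‖f 0 x‖ := by
  simp [runningMax]

theorem runningMax_succ (f : ℕ → X → E) (n : ℕ) (x : X) :
    runningMax f (n + 1) x = max (runningMax f n x) ‖f (n + 1) x‖ := by
  simp only [runningMax]
  exact partialSups_add_one _ n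

theorem norm_le_runningMax_of_le (f : ℕ → X → E) {k n : ℕ} (h : k ≤ n) (x : X) :
    ‖f k x‖ ≤ runningMax f n x :=
  le_partialSups_of_le (fun k => ‖f k x‖) h

theorem norm_le_runningMax (f : ℕ → X → E) (n : ℕ) (x : X) : ‖f n x‖ ≤ runningMax f n x :=
  norm_le_runningMax_of_le f le_rfl x

theorem runningMax_nonneg (f : ℕ → X → E) (n : ℕ) (x : X) : 0 ≤ runningMax f n x :=
  (norm_nonneg _).trans (norm_le_runningMax f n x)

theorem runningMax_mono (f : ℕ → X → E) (x : X) : Monotone fun n => runningMax f n x :=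
  partialSups_monotone _

theorem runningMax_le {f : ℕ → X → E} {n : ℕ} {x : X} {c : ℝ} (h : ∀ k ≤ n, ‖f k x‖ ≤ c) :
    runningMax f n x ≤ c :=
  partialSups_le _ _ _ h

theorem stronglyMeasurable_runningMax {ℱ : Filtration ℕ mX} {f : ℕ → X → E}
    (hf : StronglyAdapted ℱ f) (n : ℕ) : StronglyMeasurable[ℱ n] (runningMax f n) := by
  induction n with
  | zero =>
    have : runningMax f 0 = fun x => ‖f 0 x‖ := funext fun x => runningMax_zero f x
    rw [this]
    exact (hf 0).norm
  | succ n ih =>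
    have : runningMax f (n + 1) = runningMax f n ⊔ fun x => ‖f (n + 1) x‖ :=
      funext fun x => runningMax_succ f n x
    rw [this]
    exact @StronglyMeasurable.sup _ _ _ _ (ℱ (n + 1)) _ _ _ (ih.mono (ℱ.mono n.le_succ))
      (hf (n + 1)).norm

end RunningMax

/-! ### Young-type inequalities for real powers -/

theorem rpow_mul_self {x p : ℝ} (hx : 0 ≤ x) (hp : 1 ≤ p) : x ^ (p - 1) * x = x ^ p := by
  nth_rw 2 [← Real.rpow_one x]
  rw [← Real.rpow_add_of_nonneg hx (by linarith) zero_le_one, sub_add_cancel]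

theorem rpow_mul_le_young {p : ℝ} (hp : 1 < p) {a b : ℝ} (ha : 0 ≤ a) (hb : 0 ≤ b) :
    a ^ (p - 1) * b ≤ (1 - 1 / p) * a ^ p + 1 / p * b ^ p := by
  have hp0 : 0 < p := by linarith
  have h1 : 0 ≤ 1 - 1 / p := by
    rw [sub_nonneg, div_le_one hp0]; exact hp.le
  have h := Real.geom_mean_le_arith_mean2_weighted h1 (by positivity : 0 ≤ 1 / p)
    (Real.rpow_nonneg ha p) (Real.rpow_nonneg hb p) (by ring)
  rw [← Real.rpow_mul ha, ← Real.rpow_mul hb] at h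
  have e1 : p * (1 - 1 / p) = p - 1 := by field_simp
  have e2 : p * (1 / p) = 1 := by field_simp
  rwa [e1, e2, Real.rpow_one] at h

/-- Young's inequality with a small constant on the first term. -/
theorem exists_rpow_mul_rpow_le {r s ε : ℝ} (hr : 0 ≤ r) (hs : 0 < s) (hε : 0 < ε) :
    ∃ K : ℝ, 0 ≤ K ∧ ∀ a b : ℝ, 0 ≤ a → 0 ≤ b →
      a ^ r * b ^ s ≤ ε * a ^ (r + s) + K * b ^ (r + s) := by
  set δ : ℝ := ε ^ (1 / s) with hδ_def
  have hδ : 0 < δ := Real.rpow_pos_of_pos hε _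
  have hδs : δ ^ s = ε := by
    rw [hδ_def, ← Real.rpow_mul hε.le, one_div_mul_cancel hs.ne', Real.rpow_one]
  refine ⟨δ⁻¹ ^ r, by positivity, fun a b ha hb => ?_⟩
  rw [Real.rpow_add_of_nonneg ha hr hs.le, Real.rpow_add_of_nonneg hb hr hs.le]
  have har := Real.rpow_nonneg ha r
  have has := Real.rpow_nonneg ha s
  have hbr := Real.rpow_nonneg hb r
  have hbs := Real.rpow_nonneg hb s
  have hK : 0 ≤ δ⁻¹ ^ r := by positivity
  -- Since δ^s = ε, the case b ≤ δa is paid by the first term; otherwise a ≤ δ⁻¹b and the second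
  -- term pays.
  rcases le_total b (δ * a) with h | h
  · have h1 : b ^ s ≤ ε * a ^ s := by
      rw [← hδs, ← Real.mul_rpow hδ.le ha]
      exact Real.rpow_le_rpow hb h hs.le
    have h2 := mul_le_mul_of_nonneg_left h1 har
    have h3 : 0 ≤ δ⁻¹ ^ r * (b ^ r * b ^ s) := by positivity
    linarith
  · have h1 : a ^ r ≤ δ⁻¹ ^ r * b ^ r := by
      rw [← Real.mul_rpow (by positivity) hb]
      refine Real.rpow_le_rpow ha ?_ hr
      rw [inv_mul_eq_div, le_div_iff₀ hδ]
      linarith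
    have h2 := mul_le_mul_of_nonneg_right h1 hbs
    have h3 : 0 ≤ ε * (a ^ r * a ^ s) := by positivity
    linarith

/-! ### Doob's inequality in L^p -/

section Doob

variable {X E : Type*} {mX : MeasurableSpace X} {μ : Measure X}
  [NormedAddCommGroup E] [InnerProductSpace ℝ E] [CompleteSpace E]

theorem integrable_runningMax_rpow {F : Type*} [NormedAddCommGroup F] {ℱ : Filtration ℕ mX}
    {f : ℕ → X → F} (hf : StronglyAdapted ℱ f) {p : ℝ}
    (hfp : ∀ n, Integrable (fun x => ‖f n x‖ ^ p) μ) (n : ℕ) :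
    Integrable (fun x => runningMax f n x ^ p) μ := by
  induction n with
  | zero => simpa only [runningMax_zero] using hfp 0
  | succ n ih =>
    refine (ih.add (hfp (n + 1))).mono' ?_ (Filter.Eventually.of_forall fun x => ?_)
    · exact (((stronglyMeasurable_runningMax hf (n + 1)).mono (ℱ.le _)).measurable.pow_const
        p).aestronglyMeasurable
    · rw [Real.norm_of_nonneg (Real.rpow_nonneg (runningMax_nonneg _ _ _) _), runningMax_succ]
      have h1 := Real.rpow_nonneg (runningMax_nonneg f n x) p
      have h2 := Real.rpow_nonneg (norm_nonneg (f (n + 1) x)) p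
      rcases le_total (runningMax f n x) ‖f (n + 1) x‖ with h | h
      · rw [max_eq_right h]; simpa using h1
      · rw [max_eq_left h]; simpa using h2

/-- Induction on time: the maximum changes only when the new norm s exceeds it, and then Young's
inequality for Y_n^(p-1) s is exactly what is needed. The term Y_n^(p-1) ‖f_n‖ passes to time n + 1
by the submartingale property, its weight being known at time n. -/
theorem integral_runningMax_rpow_le_integral_mul {ℱ : Filtration ℕ mX} [SigmaFiniteFiltration μ ℱ]
    {f : ℕ → X → E} (hf : Martingale f ℱ μ) {p : ℝ} (hp : 1 < p)
    (hfp : ∀ n, Integrable (fun x => ‖f n x‖ ^ p) μ) (n : ℕ) :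
    Integrable (fun x => runningMax f n x ^ (p - 1) * ‖f n x‖) μ ∧
    (1 - 1 / p) * ∫ x, runningMax f n x ^ p ∂μ ≤
      ∫ x, runningMax f n x ^ (p - 1) * ‖f n x‖ ∂μ := by
  have hY := integrable_runningMax_rpow hf.1 hfp
  have hYm := stronglyMeasurable_runningMax hf.1
  have hYpow : ∀ n, StronglyMeasurable[ℱ n] (fun x => runningMax f n x ^ (p - 1)) := fun n =>
    ((hYm n).measurable.pow_const (p - 1)).stronglyMeasurable
  have hint : ∀ m n k, m ≤ n → k ≤ n →
      Integrable (fun x => runningMax f m x ^ (p - 1) * ‖f k x‖) μ := by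
    intro m n k hmn hkn
    refine (hY n).mono' (((hYpow m).mono (ℱ.le m)).mul
      ((hf.1 k).mono (ℱ.le k)).norm).aestronglyMeasurable (Filter.Eventually.of_forall fun x => ?_)
    have h0 := runningMax_nonneg f m x
    have h0' := runningMax_nonneg f n x
    rw [Real.norm_of_nonneg (mul_nonneg (Real.rpow_nonneg h0 _) (norm_nonneg _))]
    calc runningMax f m x ^ (p - 1) * ‖f k x‖
        ≤ runningMax f n x ^ (p - 1) * runningMax f n x := by
          gcongr
          · exact runningMax_mono f x hmn
          · exact norm_le_runningMax_of_le f hkn x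
      _ = runningMax f n x ^ p := rpow_mul_self h0' hp.le
  refine ⟨hint n n n le_rfl le_rfl, ?_⟩
  have hp0 : 0 < p := by linarith
  induction n with
  | zero =>
    rw [← integral_const_mul]
    refine integral_mono ((hY 0).const_mul _) (hint 0 0 0 le_rfl le_rfl) fun x => ?_
    have h0 : 0 ≤ ‖f 0 x‖ := norm_nonneg _
    simp only [runningMax_zero]
    rw [rpow_mul_self h0 hp.le]
    refine mul_le_of_le_one_left (Real.rpow_nonneg h0 _) ?_
    have : 0 < 1 / p := by positivity
    linarith
  | succ n ih =>
    have hsub := integral_mul_norm_le hf (Nat.le_succ n) (hYpow n)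
      (fun x => Real.rpow_nonneg (runningMax_nonneg f n x) _) (hint n n n le_rfl le_rfl)
      (hint n (n + 1) (n + 1) n.le_succ le_rfl)
    have hi1 := hint n (n + 1) (n + 1) n.le_succ le_rfl
    have hi2 := hint (n + 1) (n + 1) (n + 1) le_rfl le_rfl
    have key : ∫ x, ((1 - 1 / p) * runningMax f (n + 1) x ^ p
          + runningMax f n x ^ (p - 1) * ‖f (n + 1) x‖) ∂μ
        ≤ ∫ x, ((1 - 1 / p) * runningMax f n x ^ p
          + runningMax f (n + 1) x ^ (p - 1) * ‖f (n + 1) x‖) ∂μ := by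
      refine integral_mono (((hY (n + 1)).const_mul _).add hi1) (((hY n).const_mul _).add hi2)
        fun x => ?_
      simp only [runningMax_succ]
      have h0 := runningMax_nonneg f n x
      have h1 := norm_nonneg (f (n + 1) x)
      rcases le_total ‖f (n + 1) x‖ (runningMax f n x) with h | h
      · rw [max_eq_left h]
      · rw [max_eq_right h]
        have hy := rpow_mul_le_young hp h0 h1
        rw [rpow_mul_self h1 hp.le]
        linarith
    rw [integral_add ((hY (n + 1)).const_mul _) hi1, integral_add ((hY n).const_mul _) hi2,
      integral_const_mul, integral_const_mul] at key
    have : ∫ x, runningMax f n x ^ (p - 1) * ‖f n.succ x‖ ∂μ =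
      ∫ x, runningMax f n x ^ (p - 1) * ‖f (n + 1) x‖ ∂μ := rfl
    linarith

end Doob

/-- Doob's maximal inequality in `L^p`. -/
theorem exists_integral_runningMax_rpow_le {p : ℝ} (hp : 1 < p) :
    ∃ C : ℝ, 0 ≤ C ∧ ∀ {X : Type u} {E : Type v} {mX : MeasurableSpace X} {μ : Measure X}
      [NormedAddCommGroup E] [InnerProductSpace ℝ E] [CompleteSpace E]
      {ℱ : Filtration ℕ mX} [SigmaFiniteFiltration μ ℱ] {f : ℕ → X → E},
      Martingale f ℱ μ → (∀ n, Integrable (fun x => ‖f n x‖ ^ p) μ) → ∀ n,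
      ∫ x, runningMax f n x ^ p ∂μ ≤ C * ∫ x, ‖f n x‖ ^ p ∂μ := by
  have hp0 : 0 < p := by linarith
  have hc : 0 < 1 - 1 / p := by
    rw [sub_pos, div_lt_one hp0]; exact hp
  set c := 1 - 1 / p with hc_def
  -- With ε = c/2, half of the left side is absorbed, which is legitimate because the integral of
  -- the running maximum is finite.
  obtain ⟨K, hK0, hK⟩ := exists_rpow_mul_rpow_le (r := p - 1) (s := 1) (ε := c / 2)
    (by linarith) one_pos (by positivity)
  refine ⟨2 * K / c, by positivity, ?_⟩
  intro X E mX μ _ _ _ ℱ _ f hf hfp n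
  obtain ⟨hi, h⟩ := integral_runningMax_rpow_le_integral_mul hf hp hfp n
  have hY := integrable_runningMax_rpow hf.1 hfp n
  have h2 : ∫ x, runningMax f n x ^ (p - 1) * ‖f n x‖ ∂μ
      ≤ ∫ x, (c / 2 * runningMax f n x ^ p + K * ‖f n x‖ ^ p) ∂μ := by
    refine integral_mono hi ((hY.const_mul _).add ((hfp n).const_mul _)) fun x => ?_
    have := hK _ _ (runningMax_nonneg f n x) (norm_nonneg (f n x))
    simpa only [Real.rpow_one, sub_add_cancel] using this
  rw [integral_add (hY.const_mul _) ((hfp n).const_mul _), integral_const_mul,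
    integral_const_mul] at h2
  rw [← hc_def] at h
  rw [div_mul_eq_mul_div, le_div_iff₀ hc]
  linarith

/-! ### Weighted Doob inequality in L² -/

/-- One time step for the potential w(m² - 2sm), where m is the maximum, s the current norm and w
the weight. Whether or not s' is a new maximum, the left side is at most w'm² + 2(w - w')ms', while
the right side is wm² + 2d. -/
theorem doob_step_le {w w' m s s' d : ℝ} (hw' : 0 ≤ w') (h1 : 0 ≤ (w - w') * m ^ 2)
    (h2 : (w - w') * m * s' ≤ d) :
    w' * (max m s' ^ 2 - 2 * (s' * max m s')) + 2 * (w * m * s') ≤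
      w * (m ^ 2 - 2 * (s * m)) + 2 * (w * m * s) + 2 * d := by
  rcases le_total s' m with h | h
  · rw [max_eq_left h]
    nlinarith
  · rw [max_eq_right h]
    nlinarith [mul_nonneg hw' (sq_nonneg (s' - m))]

section Weighted

variable {X E : Type*} {mX : MeasurableSpace X} {μ : Measure X}
  [NormedAddCommGroup E] [InnerProductSpace ℝ E] [CompleteSpace E]

/-- Doob's maximal inequality in `L^2` with adapted weights `w`. The process `D` controls the error
caused by the variation of the weights. -/
theorem integral_weight_mul_runningMax_sq_le {ℱ : Filtration ℕ mX} [SigmaFiniteFiltration μ ℱ]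
    {f : ℕ → X → E} (hf : Martingale f ℱ μ) {w D : ℕ → X → ℝ}
    (hw : ∀ n, StronglyMeasurable[ℱ n] (w n)) (hw0 : ∀ n x, 0 ≤ w n x)
    (hw1 : ∀ n x, 0 ≤ (w n x - w (n + 1) x) * runningMax f n x ^ 2)
    (hw2 : ∀ n x, (w n x - w (n + 1) x) * runningMax f n x * ‖f (n + 1) x‖ ≤
      D (n + 1) x - D n x)
    (hD : ∀ n, Integrable (D n) μ)
    (hint : ∀ n, Integrable (fun x => w n x * (runningMax f n x * runningMax f (n + 1) x)) μ)
    (n : ℕ) :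
    Integrable (fun x => w n x * runningMax f n x ^ 2) μ ∧
    Integrable (fun x => w n x * ‖f n x‖ ^ 2) μ ∧
    ∫ x, w n x * runningMax f n x ^ 2 ∂μ ≤
      4 * (∫ x, D n x ∂μ - ∫ x, D 0 x ∂μ) + 4 * ∫ x, w n x * ‖f n x‖ ^ 2 ∂μ := by
  have hMm := fun n => (stronglyMeasurable_runningMax hf.1 n)
  -- The majorant pairs the maxima at times n and n + 1 because the weight at time n is also
  -- integrated against the norm at time n + 1.
  have dom : ∀ n (g : X → ℝ), StronglyMeasurable g → (∀ x, 0 ≤ g x) →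
      (∀ x, g x ≤ runningMax f n x * runningMax f (n + 1) x) →
      Integrable (fun x => w n x * g x) μ := by
    intro n g hg hg0 hgle
    refine (hint n).mono' (((hw n).mono (ℱ.le n)).mul hg).aestronglyMeasurable
      (Filter.Eventually.of_forall fun x => ?_)
    rw [Real.norm_of_nonneg (mul_nonneg (hw0 n x) (hg0 x))]
    exact mul_le_mul_of_nonneg_left (hgle x) (hw0 n x)
  have hmono : ∀ n x, runningMax f n x ≤ runningMax f (n + 1) x := fun n x =>
    runningMax_mono f x n.le_succ
  have hM0 := runningMax_nonneg f
  have hSM := norm_le_runningMax f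
  have i1 : ∀ n, Integrable (fun x => w n x * runningMax f n x ^ 2) μ := fun n =>
    dom n _ (((hMm n).mono (ℱ.le n)).pow 2) (fun x => sq_nonneg _) fun x => by
      rw [sq]; exact mul_le_mul_of_nonneg_left (hmono n x) (hM0 n x)
  have i2 : ∀ n, Integrable (fun x => w n x * (‖f n x‖ * runningMax f n x)) μ := fun n =>
    dom n _ (((hf.1 n).mono (ℱ.le n)).norm.mul ((hMm n).mono (ℱ.le n)))
      (fun x => mul_nonneg (norm_nonneg _) (hM0 n x)) fun x =>
        mul_le_mul (hSM n x) (hmono n x) (hM0 n x) (hM0 n x)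
  have i3 : ∀ n, Integrable (fun x => w n x * ‖f n x‖ ^ 2) μ := fun n =>
    dom n _ (((hf.1 n).mono (ℱ.le n)).norm.pow 2) (fun x => sq_nonneg _) fun x => by
      rw [sq]; exact mul_le_mul (hSM n x) ((hSM n x).trans (hmono n x)) (norm_nonneg _) (hM0 n x)
  have i4 : ∀ n, Integrable (fun x => w n x * runningMax f n x * ‖f n x‖) μ := fun n => by
    refine (i2 n).congr (Filter.Eventually.of_forall fun x => ?_)
    simp only; ring
  have i5 : ∀ n, Integrable (fun x => w n x * runningMax f n x * ‖f (n + 1) x‖) μ := fun n => by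
    have := dom n (fun x => runningMax f n x * ‖f (n + 1) x‖)
      (((hMm n).mono (ℱ.le n)).mul ((hf.1 (n + 1)).mono (ℱ.le _)).norm)
      (fun x => mul_nonneg (hM0 n x) (norm_nonneg _)) fun x =>
        mul_le_mul_of_nonneg_left (hSM (n + 1) x) (hM0 n x)
    refine this.congr (Filter.Eventually.of_forall fun x => ?_)
    simp only; ring
  have i6 : ∀ n, Integrable
      (fun x => w n x * (runningMax f n x ^ 2 - 2 * (‖f n x‖ * runningMax f n x))) μ := fun n => by
    refine ((i1 n).sub ((i2 n).const_mul 2)).congr (Filter.Eventually.of_forall fun x => ?_)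
    simp only [Pi.sub_apply]; ring
  have main : ∫ x, w n x * (runningMax f n x ^ 2 - 2 * (‖f n x‖ * runningMax f n x)) ∂μ ≤
      2 * (∫ x, D n x ∂μ - ∫ x, D 0 x ∂μ) := by
    induction n with
    | zero =>
      rw [sub_self, mul_zero]
      refine integral_nonpos fun x => ?_
      simp only [runningMax_zero, Pi.zero_apply]
      nlinarith [mul_nonneg (hw0 0 x) (sq_nonneg ‖f 0 x‖)]
    | succ n ih =>
      have hsub := integral_mul_norm_le hf (Nat.le_succ n) ((hw n).mul (hMm n))
        (fun x => mul_nonneg (hw0 n x) (hM0 n x)) (i4 n) (i5 n)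
      have hd : Integrable (fun x => D (n + 1) x - D n x) μ := (hD (n + 1)).sub (hD n)
      have key := integral_mono (μ := μ) ((i6 (n + 1)).add ((i5 n).const_mul 2))
        (((i6 n).add ((i4 n).const_mul 2)).add (hd.const_mul 2)) fun x => by
          have := doob_step_le (s := ‖f n x‖) (hw0 (n + 1) x) (hw1 n x) (hw2 n x)
          simp only [Pi.add_apply, runningMax_succ f n x]
          exact this
      rw [integral_add' (i6 (n + 1)) ((i5 n).const_mul 2),
        integral_add' ((i6 n).add ((i4 n).const_mul 2)) (hd.const_mul 2),
        integral_add' (i6 n) ((i4 n).const_mul 2), integral_const_mul, integral_const_mul,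
        integral_const_mul, integral_sub (hD (n + 1)) (hD n)] at key
      simp only [Pi.mul_apply, Nat.succ_eq_add_one] at hsub
      linarith
  refine ⟨i1 n, i3 n, ?_⟩
  -- The potential is converted to M² through M²/2 ≤ (M² - 2sM) + 2s², that is (M - 2s)² ≥ 0;
  -- doubling gives both factors 4.
  have hle := integral_mono (μ := μ) ((i1 n).const_mul (1 / 2)) ((i6 n).add ((i3 n).const_mul 2))
    fun x => by
      simp only [Pi.add_apply]
      nlinarith [mul_nonneg (hw0 n x) (sq_nonneg (runningMax f n x - 2 * ‖f n x‖))]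
  rw [integral_add' (i6 n) ((i3 n).const_mul 2), integral_const_mul, integral_const_mul] at hle
  linarith

end Weighted

/-! ### Maximal increments and block oscillation -/

section IncrMax

variable {X E : Type*} {mX : MeasurableSpace X} {μ : Measure X} [NormedAddCommGroup E]

/-- The maximal increment `max_{i ≤ k} ‖f (a + i) - f a‖`. -/
def incrMax (f : ℕ → X → E) (a k : ℕ) (x : X) : ℝ :=
  runningMax (fun i x => f (a + i) x - f a x) k x

theorem incrMax_nonneg (f : ℕ → X → E) (a k : ℕ) (x : X) : 0 ≤ incrMax f a k x :=
  runningMax_nonneg _ _ _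

theorem norm_sub_le_two_mul_runningMax (f : ℕ → X → E) {a b n : ℕ} (ha : a ≤ n) (hb : b ≤ n)
    (x : X) : ‖f b x - f a x‖ ≤ 2 * runningMax f n x := by
  have h1 := norm_le_runningMax_of_le f ha x
  have h2 := norm_le_runningMax_of_le f hb x
  have h3 := norm_sub_le (f b x) (f a x)
  linarith

theorem incrMax_le (f : ℕ → X → E) (a k : ℕ) (x : X) :
    incrMax f a k x ≤ 2 * runningMax f (a + k) x :=
  runningMax_le fun _ hi =>
    norm_sub_le_two_mul_runningMax f (Nat.le_add_right a k) (Nat.add_le_add_left hi a) x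

theorem stronglyMeasurable_incrMax {ℱ : Filtration ℕ mX} {f : ℕ → X → E}
    (hf : StronglyAdapted ℱ f) (a k : ℕ) : StronglyMeasurable[ℱ (a + k)] (incrMax f a k) :=
  stronglyMeasurable_runningMax
    (ℱ := reindexFiltration ℱ (fun k => a + k) (fun _ _ h => Nat.add_le_add_left h a))
    (f := fun i x => f (a + i) x - f a x)
    (fun i => (hf (a + i)).sub ((hf a).mono (ℱ.mono (Nat.le_add_right a i)))) k

/-- The square of the oscillation of `f` along the first `n` blocks of `J`. -/
def oscSq (f : ℕ → X → E) (J : ℕ → ℕ) (n : ℕ) (x : X) : ℝ :=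
  ∑ j ∈ Finset.range n, incrMax f (J j) (J (j + 1) - J j) x ^ 2

theorem oscSq_succ (f : ℕ → X → E) (J : ℕ → ℕ) (n : ℕ) (x : X) :
    oscSq f J (n + 1) x = oscSq f J n x + incrMax f (J n) (J (n + 1) - J n) x ^ 2 :=
  Finset.sum_range_succ _ _

theorem oscSq_nonneg (f : ℕ → X → E) (J : ℕ → ℕ) (n : ℕ) (x : X) : 0 ≤ oscSq f J n x :=
  Finset.sum_nonneg fun _ _ => sq_nonneg _

variable {J : ℕ → ℕ}

theorem incrMax_block_le (f : ℕ → X → E) (hJ : Monotone J) {j n : ℕ} (h : j < n) (x : X) :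
    incrMax f (J j) (J (j + 1) - J j) x ≤ 2 * runningMax f (J n) x := by
  refine (incrMax_le f _ _ x).trans ?_
  rw [Nat.add_sub_cancel' (hJ j.le_succ)]
  exact mul_le_mul_of_nonneg_left (runningMax_mono f x (hJ h)) zero_le_two

/-- The factor n is harmless: the bound serves only for integrability and for the vanishing of the
oscillation where the running maximum vanishes. -/
theorem oscSq_le (f : ℕ → X → E) (hJ : Monotone J) (n : ℕ) (x : X) :
    oscSq f J n x ≤ n * 4 * runningMax f (J n) x ^ 2 := by
  have : oscSq f J n x ≤ ∑ j ∈ Finset.range n, 4 * runningMax f (J n) x ^ 2 := by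
    refine Finset.sum_le_sum fun j hj => ?_
    have h := incrMax_block_le f hJ (Finset.mem_range.1 hj) x
    have h0 := incrMax_nonneg f (J j) (J (j + 1) - J j) x
    nlinarith
  simpa [mul_assoc] using this

theorem stronglyMeasurable_incrMax_block {ℱ : Filtration ℕ mX} {f : ℕ → X → E}
    (hf : StronglyAdapted ℱ f) (hJ : Monotone J) (j : ℕ) :
    StronglyMeasurable[ℱ (J (j + 1))] (incrMax f (J j) (J (j + 1) - J j)) := by
  have := stronglyMeasurable_incrMax hf (J j) (J (j + 1) - J j)
  rwa [Nat.add_sub_cancel' (hJ j.le_succ)] at this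

theorem stronglyMeasurable_oscSq {ℱ : Filtration ℕ mX} {f : ℕ → X → E}
    (hf : StronglyAdapted ℱ f) (hJ : Monotone J) (n : ℕ) :
    StronglyMeasurable[ℱ (J n)] (oscSq f J n) := by
  induction n with
  | zero =>
    have : oscSq f J 0 = fun _ => 0 := by ext x; simp [oscSq]
    rw [this]
    exact stronglyMeasurable_const
  | succ n ih =>
    have : oscSq f J (n + 1) =
        oscSq f J n + incrMax f (J n) (J (n + 1) - J n) ^ 2 := by
      ext x; exact oscSq_succ f J n x
    rw [this]
    exact (ih.mono (ℱ.mono (hJ n.le_succ))).add ((stronglyMeasurable_incrMax_block hf hJ n).pow 2)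

theorem sq_rpow_half {y : ℝ} (hy : 0 ≤ y) (p : ℝ) : (y ^ 2) ^ (p / 2) = y ^ p := by
  rw [← Real.rpow_natCast, ← Real.rpow_mul hy]
  congr 1
  push_cast
  ring

theorem integrable_of_le_runningMax_rpow {ℱ : Filtration ℕ mX} {f : ℕ → X → E}
    (hf : StronglyAdapted ℱ f) {p : ℝ} (hfp : ∀ n, Integrable (fun x => ‖f n x‖ ^ p) μ) (n : ℕ)
    {g : X → ℝ} (hg : StronglyMeasurable g) (hg0 : ∀ x, 0 ≤ g x) (c : ℝ)
    (hle : ∀ x, g x ≤ c * runningMax f n x ^ p) : Integrable g μ := by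
  refine ((integrable_runningMax_rpow hf hfp n).const_mul c).mono' hg.aestronglyMeasurable
    (Filter.Eventually.of_forall fun x => ?_)
  rw [Real.norm_of_nonneg (hg0 x)]
  exact hle x

theorem integrable_oscSq_rpow {ℱ : Filtration ℕ mX} {f : ℕ → X → E}
    (hf : StronglyAdapted ℱ f) (hJ : Monotone J) {p : ℝ} (hp : 0 ≤ p)
    (hfp : ∀ n, Integrable (fun x => ‖f n x‖ ^ p) μ) (n : ℕ) :
    Integrable (fun x => oscSq f J n x ^ (p / 2)) μ := by
  refine integrable_of_le_runningMax_rpow hf hfp (J n)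
    (((stronglyMeasurable_oscSq hf hJ n).mono (ℱ.le _)).measurable.pow_const
      (p / 2)).stronglyMeasurable
    (fun x => Real.rpow_nonneg (oscSq_nonneg _ _ _ _) _) ((n * 4 : ℝ) ^ (p / 2)) fun x => ?_
  rw [← sq_rpow_half (runningMax_nonneg f (J n) x), ← Real.mul_rpow (by positivity) (sq_nonneg _)]
  exact Real.rpow_le_rpow (oscSq_nonneg _ _ _ _) (oscSq_le f hJ n x) (by positivity)

end IncrMax

/-! ### Power inequalities for the weight Y^(p-2) -/

/-- For p < 2 the convention 0^(p-2) = 0 breaks the monotonicity of the weight at 0. The factor m,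
dominated by x, vanishes there and repairs it. -/
theorem rpow_sub_two_mul_nonneg {p x y m α : ℝ} (hp : p ≤ 2) (hx : 0 ≤ x) (hxy : x ≤ y)
    (hm : 0 ≤ m) (hmx : m ≤ α * x) : 0 ≤ (x ^ (p - 2) - y ^ (p - 2)) * m := by
  rcases hx.eq_or_lt with rfl | hx
  · have : m = 0 := by linarith
    simp [this]
  · refine mul_nonneg ?_ hm
    rw [sub_nonneg]
    exact Real.rpow_le_rpow_of_nonpos hx hxy (by linarith)

theorem rpow_sub_two_mul_self {x p : ℝ} (hx : 0 < x) : x ^ (p - 2) * x = x ^ (p - 1) := by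
  nth_rw 2 [← Real.rpow_one x]
  rw [← Real.rpow_add hx]
  ring_nf

/-- After m and s are replaced by multiples of x and y, the left side is x^(p-1) y - y^(p-1) x, and
x^(p-1) ≤ y^(p-1) bounds this by y^p - x^p. Variation of the weight thus costs a telescoping
quantity. -/
theorem rpow_sub_two_mul_le {p x y m s α β : ℝ} (hp1 : 1 ≤ p) (hp : p ≤ 2) (hx : 0 ≤ x)
    (hxy : x ≤ y) (hm : 0 ≤ m) (hmx : m ≤ α * x) (hs : 0 ≤ s) (hsy : s ≤ β * y) (hα : 0 ≤ α) :
    (x ^ (p - 2) - y ^ (p - 2)) * m * s ≤ α * β * (y ^ p - x ^ p) := by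
  rcases hx.eq_or_lt with rfl | hx
  · have : m = 0 := by linarith
    rcases hxy.eq_or_lt with rfl | hy
    · simp [this]
    · have hβ : 0 ≤ β := by
        by_contra h
        nlinarith
      have h0 : (0 : ℝ) ^ p = 0 := Real.zero_rpow (by linarith)
      have := Real.rpow_nonneg hy.le p
      simp only [‹m = 0›, mul_zero, zero_mul, h0, sub_zero]
      positivity
  · have hy := hx.trans_le hxy
    have hβ : 0 ≤ β := by
      by_contra h
      nlinarith
    have hd : 0 ≤ x ^ (p - 2) - y ^ (p - 2) := by
      rw [sub_nonneg]
      exact Real.rpow_le_rpow_of_nonpos hx hxy (by linarith)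
    have h1 : (x ^ (p - 2) - y ^ (p - 2)) * m * s ≤
        (x ^ (p - 2) - y ^ (p - 2)) * (α * x) * (β * y) := by gcongr
    have h2 : (x ^ (p - 2) - y ^ (p - 2)) * x * y ≤ y ^ p - x ^ p := by
      have e1 := rpow_sub_two_mul_self (p := p) hx
      have e2 := rpow_sub_two_mul_self (p := p) hy
      have e3 := rpow_mul_self hx.le hp1
      have e4 := rpow_mul_self hy.le hp1
      have h3 : x ^ (p - 1) ≤ y ^ (p - 1) := Real.rpow_le_rpow hx.le hxy (by linarith)
      have h4 := mul_le_mul_of_nonneg_right h3 (add_pos hx hy).le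
      calc (x ^ (p - 2) - y ^ (p - 2)) * x * y
          = (x ^ (p - 2) * x) * y - (y ^ (p - 2) * y) * x := by ring
        _ = x ^ (p - 1) * y - y ^ (p - 1) * x := by rw [e1, e2]
        _ ≤ y ^ (p - 1) * y - x ^ (p - 1) * x := by linarith
        _ = y ^ p - x ^ p := by rw [e3, e4]
    calc _ ≤ _ := h1
      _ = α * β * ((x ^ (p - 2) - y ^ (p - 2)) * x * y) := by ring
      _ ≤ _ := by gcongr

theorem rpow_sub_two_mul_mul_le {p x y u v α β : ℝ} (hp1 : 1 ≤ p) (hx : 0 ≤ x) (hxy : x ≤ y)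
    (hu : u ≤ α * x) (hv0 : 0 ≤ v) (hv : v ≤ β * y) (hα : 0 ≤ α) (hβ : 0 ≤ β) :
    x ^ (p - 2) * (u * v) ≤ α * β * y ^ p := by
  have hy := hx.trans hxy
  have h0 : 0 ≤ x ^ (p - 2) := Real.rpow_nonneg hx _
  have h1 : x ^ (p - 2) * (u * v) ≤ x ^ (p - 2) * ((α * x) * (β * y)) := by gcongr
  have h2 : x ^ (p - 2) * x ≤ y ^ (p - 1) := by
    rcases hx.eq_or_lt with rfl | hx
    · simpa using Real.rpow_nonneg hy (p - 1)
    · rw [rpow_sub_two_mul_self hx]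
      exact Real.rpow_le_rpow hx.le hxy (by linarith)
  calc _ ≤ _ := h1
    _ = α * β * ((x ^ (p - 2) * x) * y) := by ring
    _ ≤ α * β * (y ^ (p - 1) * y) := by gcongr
    _ = _ := by rw [rpow_mul_self hy hp1]

/-! ### The range 1 < p ≤ 2 -/

section LeTwo

variable {X E : Type*} {mX : MeasurableSpace X} {μ : Measure X}
  [NormedAddCommGroup E] [InnerProductSpace ℝ E] [CompleteSpace E]

/-- The right side is the increment of one functional of time, so that blocks telescope. The
weighted Doob inequality contributes 4 · 4 = 16 to the coefficient 36; comparing the weighted square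
of the increment with a difference of squares contributes 4 · 5 = 20. -/
theorem integral_rpow_mul_incrMax_sq_le {ℱ : Filtration ℕ mX} [SigmaFiniteFiltration μ ℱ]
    {f : ℕ → X → E} (hf : Martingale f ℱ μ) {p : ℝ} (hp1 : 1 < p) (hp2 : p ≤ 2)
    (hfp : ∀ n, Integrable (fun x => ‖f n x‖ ^ p) μ) (a k : ℕ) :
    ∫ x, runningMax f (a + k) x ^ (p - 2) * incrMax f a k x ^ 2 ∂μ ≤
      (∫ x, (4 * (runningMax f (a + k) x ^ (p - 2) * ‖f (a + k) x‖ ^ 2)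
        + 36 * runningMax f (a + k) x ^ p) ∂μ)
      - ∫ x, (4 * (runningMax f a x ^ (p - 2) * ‖f a x‖ ^ 2) + 36 * runningMax f a x ^ p) ∂μ := by
  have he : Monotone (fun k : ℕ => a + k) := fun _ _ h => Nat.add_le_add_left h a
  have := sigmaFiniteFiltration_reindex (μ := μ) ℱ _ he
  have hY0 := runningMax_nonneg f
  have hYle : ∀ k x, runningMax f a x ≤ runningMax f (a + k) x := fun k x =>
    runningMax_mono f x (Nat.le_add_right a k)
  have hYm := stronglyMeasurable_runningMax hf.1
  have hwm : ∀ n, StronglyMeasurable[ℱ n] (fun x => runningMax f n x ^ (p - 2)) := fun n =>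
    ((hYm n).measurable.pow_const (p - 2)).stronglyMeasurable
  have hwm' : ∀ n, StronglyMeasurable (fun x => runningMax f n x ^ (p - 2)) := fun n =>
    (hwm n).mono (ℱ.le n)
  have hfm : ∀ n, StronglyMeasurable (f n) := fun n => (hf.1 n).mono (ℱ.le n)
  have hYi := integrable_runningMax_rpow hf.1 hfp
  have hM2 := incrMax_le f a
  have hM0 := incrMax_nonneg f a
  have hYs : ∀ k x, runningMax f (a + k) x ≤ runningMax f (a + (k + 1)) x := fun k x =>
    runningMax_mono f x (by omega)
  obtain ⟨-, -, hD⟩ := integral_weight_mul_runningMax_sq_le (martingale_increment hf a)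
    (w := fun k x => runningMax f (a + k) x ^ (p - 2))
    (D := fun k x => 4 * runningMax f (a + k) x ^ p)
    (fun k => hwm (a + k)) (fun k x => Real.rpow_nonneg (hY0 _ x) _)
    (fun k x => by
      refine rpow_sub_two_mul_nonneg (α := 2 * (2 * runningMax f (a + k) x)) hp2 (hY0 _ x)
        (hYs k x) (sq_nonneg _) ?_
      have h1 : incrMax f a k x ≤ _ := hM2 k x
      have h2 := hM0 k x
      change incrMax f a k x ^ 2 ≤ _
      nlinarith)
    (fun k x => by
      rw [← mul_sub]
      have := rpow_sub_two_mul_le (m := incrMax f a k x) (s := ‖f (a + (k + 1)) x - f a x‖)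
        (α := 2) (β := 2) hp1.le hp2 (hY0 (a + k) x) (hYs k x) (hM0 k x)
        (hM2 k x) (norm_nonneg _)
        (norm_sub_le_two_mul_runningMax f (Nat.le_add_right _ _) le_rfl x) zero_le_two
      calc _ ≤ _ := this
        _ = _ := by ring)
    (fun k => (hYi (a + k)).const_mul 4)
    (fun k => by
      refine integrable_of_le_runningMax_rpow hf.1 hfp (a + (k + 1))
        ((hwm' (a + k)).mul (((stronglyMeasurable_incrMax hf.1 a k).mono (ℱ.le _)).mul
          ((stronglyMeasurable_incrMax hf.1 a (k + 1)).mono (ℱ.le _))))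
        (fun x => mul_nonneg (Real.rpow_nonneg (hY0 _ x) _) (mul_nonneg (hM0 _ _) (hM0 _ _)))
        (2 * 2) fun x => ?_
      exact rpow_sub_two_mul_mul_le hp1.le (hY0 _ x) (hYs k x) (hM2 k x) (hM0 _ _)
        (hM2 (k + 1) x) zero_le_two zero_le_two) k
  simp only [add_zero, integral_const_mul] at hD
  set b := a + k with hb
  have hab : a ≤ b := Nat.le_add_right a k
  have hYab : ∀ x, runningMax f a x ≤ runningMax f b x := hYle k
  have hfa := norm_le_runningMax f a
  have hfb := norm_le_runningMax f b
  have hh : ∀ x, ‖f b x - f a x‖ ≤ 2 * runningMax f b x := fun x =>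
    norm_sub_le_two_mul_runningMax f hab le_rfl x
  have hself : ∀ n, Integrable (fun x => runningMax f n x ^ (p - 2) * ‖f n x‖ ^ 2) μ := fun n => by
    refine integrable_of_le_runningMax_rpow hf.1 hfp n
      ((hwm' n).mul ((hfm n).norm.pow 2))
      (fun x => mul_nonneg (Real.rpow_nonneg (hY0 _ x) _) (sq_nonneg _)) (1 * 1) fun x => ?_
    simp only [sq]
    exact rpow_sub_two_mul_mul_le hp1.le (hY0 _ x) le_rfl
      (by simpa using norm_le_runningMax f n x) (norm_nonneg _)
      (by simpa using norm_le_runningMax f n x) zero_le_one zero_le_one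
  have hinc : Integrable (fun x => runningMax f b x ^ (p - 2) * ‖f b x - f a x‖ ^ 2) μ := by
    refine integrable_of_le_runningMax_rpow hf.1 hfp b
      ((hwm' b).mul (((hfm b).sub (hfm a)).norm.pow 2))
      (fun x => mul_nonneg (Real.rpow_nonneg (hY0 _ x) _) (sq_nonneg _)) (2 * 2) fun x => ?_
    simp only [sq]
    exact rpow_sub_two_mul_mul_le hp1.le (hY0 _ x) le_rfl (hh x) (norm_nonneg _) (hh x)
      zero_le_two zero_le_two
  have hψ : StronglyMeasurable[ℱ a] (fun x => runningMax f a x ^ (p - 2) • f a x) :=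
    (hwm a).smul (hf.1 a)
  have horth : Integrable
      (fun x => inner ℝ (runningMax f a x ^ (p - 2) • f a x) (f b x - f a x)) μ := by
    refine ((hYi b).const_mul (1 * 2)).mono' ?_ (Filter.Eventually.of_forall fun x => ?_)
    · exact (hψ.mono (ℱ.le a)).aestronglyMeasurable.inner
        ((hfm b).sub (hfm a)).aestronglyMeasurable
    · refine (norm_inner_le_norm _ _).trans ?_
      rw [norm_smul, Real.norm_of_nonneg (Real.rpow_nonneg (hY0 _ x) _), mul_assoc]
      exact rpow_sub_two_mul_mul_le hp1.le (hY0 _ x) (hYab x) (by simpa using hfa x)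
        (norm_nonneg _) (hh x) zero_le_one zero_le_two
  have hzero := integral_inner_martingale_sub hf hab hψ horth
  -- Orthogonality needs the weight at time a, not b. Switching weights costs one increment of Y^p
  -- for ‖f_a‖² and 2 · 2 for the cross term, hence 5.
  have hA : ∫ x, runningMax f b x ^ (p - 2) * ‖f b x - f a x‖ ^ 2 ∂μ ≤
      ∫ x, (((runningMax f b x ^ (p - 2) * ‖f b x‖ ^ 2 - runningMax f a x ^ (p - 2) * ‖f a x‖ ^ 2)
        + 5 * (runningMax f b x ^ p - runningMax f a x ^ p))
        - 2 * inner ℝ (runningMax f a x ^ (p - 2) • f a x) (f b x - f a x)) ∂μ := by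
    refine integral_mono hinc
      ((((hself b).sub (hself a)).add (((hYi b).sub (hYi a)).const_mul 5)).sub
        (horth.const_mul 2)) fun x => ?_
    have e : ‖f b x - f a x‖ ^ 2 =
        ‖f b x‖ ^ 2 - ‖f a x‖ ^ 2 - 2 * inner ℝ (f a x) (f b x - f a x) := by
      rw [@norm_sub_sq_real, inner_sub_right, real_inner_self_eq_norm_sq, real_inner_comm]
      ring
    have h1 := rpow_sub_two_mul_le (m := ‖f a x‖) (s := ‖f a x‖) (α := 1) (β := 1) hp1.le hp2
      (hY0 a x) (hYab x) (norm_nonneg _) (by simpa using hfa x) (norm_nonneg _)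
      (by simpa using (hfa x).trans (hYab x)) zero_le_one
    have h2 := rpow_sub_two_mul_le (m := ‖f a x‖) (s := ‖f b x - f a x‖) (α := 1) (β := 2)
      hp1.le hp2 (hY0 a x) (hYab x) (norm_nonneg _) (by simpa using hfa x) (norm_nonneg _)
      (hh x) zero_le_one
    have hin := abs_le.1 (abs_real_inner_le_norm (f a x) (f b x - f a x))
    have h3 := rpow_sub_two_mul_nonneg
      (m := ‖f a x‖ * ‖f b x - f a x‖ - inner ℝ (f a x) (f b x - f a x))
      (α := 2 * ‖f b x - f a x‖) hp2 (hY0 a x) (hYab x) (by linarith) (by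
        have := mul_le_mul_of_nonneg_right (hfa x) (norm_nonneg (f b x - f a x))
        linarith)
    simp only [real_inner_smul_left]
    rw [e]
    nlinarith
  have j1 : Integrable (fun x => runningMax f b x ^ (p - 2) * ‖f b x‖ ^ 2
      - runningMax f a x ^ (p - 2) * ‖f a x‖ ^ 2) μ := (hself b).sub (hself a)
  have j2 : Integrable (fun x => 5 * (runningMax f b x ^ p - runningMax f a x ^ p)) μ :=
    ((hYi b).sub (hYi a)).const_mul 5
  have j3 : Integrable (fun x => (runningMax f b x ^ (p - 2) * ‖f b x‖ ^ 2
      - runningMax f a x ^ (p - 2) * ‖f a x‖ ^ 2)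
      + 5 * (runningMax f b x ^ p - runningMax f a x ^ p)) μ := j1.add j2
  rw [integral_sub j3 (horth.const_mul 2), integral_add j1 j2, integral_const_mul,
    integral_const_mul, integral_sub (hself b) (hself a), integral_sub (hYi b) (hYi a),
    hzero] at hA
  have hsplit : ∀ n, ∫ x, (4 * (runningMax f n x ^ (p - 2) * ‖f n x‖ ^ 2)
      + 36 * runningMax f n x ^ p) ∂μ = 4 * ∫ x, runningMax f n x ^ (p - 2) * ‖f n x‖ ^ 2 ∂μ
      + 36 * ∫ x, runningMax f n x ^ p ∂μ := fun n => by
    rw [integral_add ((hself n).const_mul 4) ((hYi n).const_mul 36), integral_const_mul,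
      integral_const_mul]
  rw [hsplit, hsplit]
  change ∫ x, runningMax f b x ^ (p - 2) * incrMax f a k x ^ 2 ∂μ ≤ _ at hD
  linarith

theorem integral_oscSq_rpow_le_of_le_two {ℱ : Filtration ℕ mX} [SigmaFiniteFiltration μ ℱ]
    {f : ℕ → X → E} (hf : Martingale f ℱ μ) {p : ℝ} (hp1 : 1 < p) (hp2 : p ≤ 2)
    (hfp : ∀ n, Integrable (fun x => ‖f n x‖ ^ p) μ) {J : ℕ → ℕ} (hJ : Monotone J) (N : ℕ) :
    ∫ x, oscSq f J N x ^ (p / 2) ∂μ ≤ 41 * ∫ x, runningMax f (J N) x ^ p ∂μ := by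
  have hY0 := runningMax_nonneg f
  have hwm : ∀ n, StronglyMeasurable (fun x => runningMax f n x ^ (p - 2)) := fun n =>
    (((stronglyMeasurable_runningMax hf.1 n).mono
      (ℱ.le n)).measurable.pow_const (p - 2)).stronglyMeasurable
  have hYi := integrable_runningMax_rpow hf.1 hfp
  set B : ℕ → X → ℝ := fun j => incrMax f (J j) (J (j + 1) - J j) with hB
  have hB0 : ∀ j x, 0 ≤ B j x := fun j x => incrMax_nonneg _ _ _ _
  set Ψ : ℕ → ℝ := fun n => ∫ x, (4 * (runningMax f n x ^ (p - 2) * ‖f n x‖ ^ 2)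
      + 36 * runningMax f n x ^ p) ∂μ with hΨ
  have hblock : ∀ j, ∫ x, runningMax f (J (j + 1)) x ^ (p - 2) * B j x ^ 2 ∂μ ≤
      Ψ (J (j + 1)) - Ψ (J j) := fun j => by
    have := integral_rpow_mul_incrMax_sq_le hf hp1 hp2 hfp (J j) (J (j + 1) - J j)
    rwa [Nat.add_sub_cancel' (hJ j.le_succ)] at this
  have hBint : ∀ j n, j < n → Integrable (fun x => runningMax f (J n) x ^ (p - 2) * B j x ^ 2) μ :=
    fun j n hjn => by
    refine integrable_of_le_runningMax_rpow hf.1 hfp (J n)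
      ((hwm _).mul (((stronglyMeasurable_incrMax_block hf.1 hJ j).mono (ℱ.le _)).pow 2))
      (fun x => mul_nonneg (Real.rpow_nonneg (hY0 _ x) _) (sq_nonneg _)) (2 * 2) fun x => ?_
    simp only [sq]
    exact rpow_sub_two_mul_mul_le hp1.le (hY0 _ x) le_rfl (incrMax_block_le f hJ hjn x)
      (hB0 j x) (incrMax_block_le f hJ hjn x) zero_le_two zero_le_two
  have hΨ0 : ∀ n, 0 ≤ Ψ n := fun n => integral_nonneg fun x => by
    have h1 := Real.rpow_nonneg (hY0 n x) p
    have h2 := Real.rpow_nonneg (hY0 n x) (p - 2)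
    simp only [Pi.zero_apply]
    positivity
  have hΨle : ∀ n, Ψ n ≤ 40 * ∫ x, runningMax f n x ^ p ∂μ := fun n => by
    rw [← integral_const_mul]
    refine integral_mono_of_nonneg (Filter.Eventually.of_forall fun x => ?_)
      ((hYi n).const_mul 40) (Filter.Eventually.of_forall fun x => ?_)
    · have h1 := Real.rpow_nonneg (hY0 n x) p
      have h2 := Real.rpow_nonneg (hY0 n x) (p - 2)
      simp only [Pi.zero_apply]
      positivity
    · have := rpow_sub_two_mul_mul_le (u := ‖f n x‖) (v := ‖f n x‖) (α := 1) (β := 1) hp1.le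
        (hY0 n x) le_rfl (by simpa using norm_le_runningMax f n x) (norm_nonneg _)
        (by simpa using norm_le_runningMax f n x) zero_le_one zero_le_one
      simp only [sq]
      linarith
  have hsum : ∑ j ∈ Finset.range N, ∫ x, runningMax f (J (j + 1)) x ^ (p - 2) * B j x ^ 2 ∂μ ≤
      40 * ∫ x, runningMax f (J N) x ^ p ∂μ := by
    calc _ ≤ ∑ j ∈ Finset.range N, (Ψ (J (j + 1)) - Ψ (J j)) :=
          Finset.sum_le_sum fun j _ => hblock j
      _ = Ψ (J N) - Ψ (J 0) := Finset.sum_range_sub (fun j => Ψ (J j)) N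
      _ ≤ Ψ (J N) := by linarith [hΨ0 (J 0)]
      _ ≤ _ := hΨle _
  have hsi : Integrable (fun x => ∑ j ∈ Finset.range N,
      runningMax f (J (j + 1)) x ^ (p - 2) * B j x ^ 2) μ :=
    integrable_finsetSum _ fun j _ => hBint j (j + 1) j.lt_succ_self
  -- If O ≤ Y² then O^(p/2) ≤ Y^p; otherwise O^(p/2-1) ≤ Y^(p-2) since the exponent is nonpositive.
  -- The weight at the last time is below those at the block ends.
  have hpt : ∀ x, oscSq f J N x ^ (p / 2) ≤ (∑ j ∈ Finset.range N,
      runningMax f (J (j + 1)) x ^ (p - 2) * B j x ^ 2) + runningMax f (J N) x ^ p := by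
    intro x
    have hw : runningMax f (J N) x ^ (p - 2) * oscSq f J N x ≤ ∑ j ∈ Finset.range N,
        runningMax f (J (j + 1)) x ^ (p - 2) * B j x ^ 2 := by
      rw [oscSq, Finset.mul_sum]
      refine Finset.sum_le_sum fun j hj => ?_
      have hjN := Finset.mem_range.1 hj
      have h1 := incrMax_block_le f hJ j.lt_succ_self x
      have h2 := rpow_sub_two_mul_nonneg (m := B j x ^ 2) (α := 2 * (2 * runningMax f (J (j + 1)) x))
        hp2 (hY0 (J (j + 1)) x) (runningMax_mono f x (hJ hjN)) (sq_nonneg _) (by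
          have := hB0 j x
          simp only [hB] at this ⊢
          nlinarith)
      simp only [hB] at h2 ⊢
      linarith
    refine le_trans ?_ (add_le_add_left hw _)
    have hO := oscSq_nonneg f J N x
    have hOle := oscSq_le f hJ N x
    have hYN := hY0 (J N) x
    set Y := runningMax f (J N) x
    set O := oscSq f J N x
    rcases hYN.eq_or_lt with h | h
    · have : O = 0 := by
        rw [← h] at hOle
        simp only [ne_eq, OfNat.ofNat_ne_zero, not_false_eq_true, zero_pow, mul_zero] at hOle
        linarith
      rw [this, Real.zero_rpow (by linarith), mul_zero, zero_add]
      exact Real.rpow_nonneg hYN p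
    · have hYp := Real.rpow_nonneg hYN p
      have hYp2 := Real.rpow_nonneg hYN (p - 2)
      rcases le_total O (Y ^ 2) with hc | hc
      · have : O ^ (p / 2) ≤ Y ^ p := by
          rw [← sq_rpow_half hYN]
          exact Real.rpow_le_rpow hO hc (by linarith)
        have := mul_nonneg hYp2 hO
        linarith
      · have hOpos : 0 < O := lt_of_lt_of_le (by positivity) hc
        have : O ^ (p / 2) ≤ Y ^ (p - 2) * O := by
          rw [← sq_rpow_half hYN, show p / 2 = (p - 2) / 2 + 1 by ring, Real.rpow_add hOpos,
            Real.rpow_one]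
          exact mul_le_mul_of_nonneg_right
            (Real.rpow_le_rpow_of_nonpos (by positivity) hc (by linarith)) hO
        linarith
  calc ∫ x, oscSq f J N x ^ (p / 2) ∂μ
      ≤ ∫ x, ((∑ j ∈ Finset.range N, runningMax f (J (j + 1)) x ^ (p - 2) * B j x ^ 2)
        + runningMax f (J N) x ^ p) ∂μ :=
        integral_mono (integrable_oscSq_rpow hf.1 hJ (by linarith) hfp N) (hsi.add (hYi _)) hpt
    _ ≤ _ := by
      rw [integral_add hsi (hYi _), integral_finsetSum _ fun j _ => hBint j (j + 1) j.lt_succ_self]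
      linarith

end LeTwo

/-! ### The range p > 2 -/

theorem rpow_mul_sq_le {q A Y c : ℝ} (hq : 1 ≤ q) (hA : 0 ≤ A) (hc : 0 ≤ c) (hY : 0 ≤ Y)
    (h : A ≤ c * Y ^ 2) : A ^ (q - 1) * Y ^ 2 ≤ c ^ (q - 1) * Y ^ (2 * q) := by
  have e : Y ^ (2 * q) = (Y ^ 2) ^ (q - 1) * Y ^ 2 := by
    rw [rpow_mul_self (sq_nonneg Y) hq, ← sq_rpow_half hY]
    congr 1; ring
  rw [e, ← mul_assoc, ← Real.mul_rpow hc (sq_nonneg Y)]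
  gcongr

/-- This is convexity of t^q: its graph lies above the tangent at a + b. -/
theorem add_rpow_le {q a b : ℝ} (hq : 1 < q) (ha : 0 ≤ a) (hb : 0 ≤ b) :
    (a + b) ^ q ≤ a ^ q + q * ((a + b) ^ (q - 1) * b) := by
  have hq0 : 0 < q := by linarith
  have h := rpow_mul_le_young hq (add_nonneg ha hb) ha
  have e := rpow_mul_self (add_nonneg ha hb) hq.le
  have h2 := mul_le_mul_of_nonneg_left h hq0.le
  have e2 : q * ((1 - 1 / q) * (a + b) ^ q + 1 / q * a ^ q) = (q - 1) * (a + b) ^ q + a ^ q := by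
    field_simp
  rw [e2] at h2
  nlinarith

theorem add_rpow_le_two_rpow_mul {r a b : ℝ} (hr : 0 ≤ r) (ha : 0 ≤ a) (hb : 0 ≤ b) :
    (a + b) ^ r ≤ 2 ^ r * (a ^ r + b ^ r) := by
  have har := Real.rpow_nonneg ha r
  have hbr := Real.rpow_nonneg hb r
  have h2 : (0 : ℝ) ≤ 2 ^ r := by positivity
  rcases le_total a b with h | h
  · calc (a + b) ^ r ≤ (2 * b) ^ r := Real.rpow_le_rpow (by positivity) (by linarith) hr
      _ = 2 ^ r * b ^ r := Real.mul_rpow zero_le_two hb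
      _ ≤ _ := by gcongr; linarith
  · calc (a + b) ^ r ≤ (2 * a) ^ r := Real.rpow_le_rpow (by positivity) (by linarith) hr
      _ = 2 ^ r * a ^ r := Real.mul_rpow zero_le_two ha
      _ ≤ _ := by gcongr; linarith

section GtTwo

variable {X E : Type*} {mX : MeasurableSpace X} {μ : Measure X}

/-- Convexity produces the weight O_(j+1)^(q-1), which depends on block j itself. Splitting off B_j²
leaves O_j^(q-1), known at the start of the block, and a remainder bounded through B_j² ≤ 4Y². -/
theorem oscSq_rpow_le [NormedAddCommGroup E] (f : ℕ → X → E) {J : ℕ → ℕ} (hJ : Monotone J) {q : ℝ}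
    (hq : 1 < q) {n N : ℕ} (hn : n ≤ N) (x : X) :
    oscSq f J n x ^ q ≤ q * 2 ^ (q - 1) *
      ((∑ j ∈ Finset.range n, oscSq f J j x ^ (q - 1) * incrMax f (J j) (J (j + 1) - J j) x ^ 2)
        + (4 * runningMax f (J N) x ^ 2) ^ (q - 1) * oscSq f J n x) := by
  induction n with
  | zero => simp [oscSq, Real.zero_rpow (by linarith : q ≠ 0)]
  | succ n ih =>
    have ih := ih (by omega)
    rw [Finset.sum_range_succ]
    have hb := incrMax_block_le f hJ (Nat.lt_of_succ_le hn) x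
    have hb0 := incrMax_nonneg f (J n) (J (n + 1) - J n) x
    have hA := oscSq_nonneg f J n x
    rw [oscSq_succ]
    set A := oscSq f J n x
    set B := incrMax f (J n) (J (n + 1) - J n) x
    set Z := 4 * runningMax f (J N) x ^ 2 with hZ
    have hBZ : B ^ 2 ≤ Z := by nlinarith
    have hZ0 : 0 ≤ Z := (sq_nonneg B).trans hBZ
    have h1 := add_rpow_le hq hA (sq_nonneg B)
    have h2 : (A + B ^ 2) ^ (q - 1) ≤ 2 ^ (q - 1) * (A ^ (q - 1) + Z ^ (q - 1)) := by
      refine le_trans ?_ (add_rpow_le_two_rpow_mul (by linarith) hA hZ0)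
      exact Real.rpow_le_rpow (by positivity) (by linarith) (by linarith)
    have h3 : q * ((A + B ^ 2) ^ (q - 1) * B ^ 2) ≤
        q * ((2 ^ (q - 1) * (A ^ (q - 1) + Z ^ (q - 1))) * B ^ 2) := by gcongr
    calc _ ≤ _ := h1
      _ ≤ _ := add_le_add ih h3
      _ = _ := by ring

theorem integrable_oscSq_rpow_mul_sq [NormedAddCommGroup E] {ℱ : Filtration ℕ mX} {f : ℕ → X → E}
    (hf : StronglyAdapted ℱ f) {q : ℝ} (hq : 1 ≤ q)
    (hfp : ∀ n, Integrable (fun x => ‖f n x‖ ^ (2 * q)) μ) {J : ℕ → ℕ} (hJ : Monotone J) {j n : ℕ}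
    (hn : J j ≤ n) {g : X → ℝ} (hg : StronglyMeasurable g) {c : ℝ}
    (hc : ∀ x, |g x| ≤ c * runningMax f n x) :
    Integrable (fun x => oscSq f J j x ^ (q - 1) * g x ^ 2) μ := by
  have hw : StronglyMeasurable (fun x => oscSq f J j x ^ (q - 1)) :=
    (((stronglyMeasurable_oscSq hf hJ j).mono (ℱ.le _)).measurable.pow_const
      (q - 1)).stronglyMeasurable
  refine integrable_of_le_runningMax_rpow hf hfp n (hw.mul (hg.pow 2))
    (fun x => mul_nonneg (Real.rpow_nonneg (oscSq_nonneg _ _ _ _) _) (sq_nonneg _))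
    (c ^ 2 * ((j * 4 : ℝ) ^ (q - 1))) fun x => ?_
  have hA := oscSq_nonneg f J j x
  have hY := runningMax_nonneg f n x
  have h1 : oscSq f J j x ≤ j * 4 * runningMax f n x ^ 2 := by
    refine (oscSq_le f hJ j x).trans ?_
    have := runningMax_nonneg f (J j) x
    have := runningMax_mono f x hn
    gcongr
  have h2 := rpow_mul_sq_le hq hA (by positivity) hY h1
  have h3 : g x ^ 2 ≤ c ^ 2 * runningMax f n x ^ 2 := by
    rw [← sq_abs, ← mul_pow]
    exact pow_le_pow_left₀ (abs_nonneg _) (hc x) 2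
  have hAr := Real.rpow_nonneg hA (q - 1)
  calc oscSq f J j x ^ (q - 1) * g x ^ 2
      ≤ oscSq f J j x ^ (q - 1) * (c ^ 2 * runningMax f n x ^ 2) := by gcongr
    _ = c ^ 2 * (oscSq f J j x ^ (q - 1) * runningMax f n x ^ 2) := by ring
    _ ≤ c ^ 2 * ((j * 4 : ℝ) ^ (q - 1) * runningMax f n x ^ (2 * q)) := by gcongr
    _ = _ := by ring

variable [NormedAddCommGroup E] [InnerProductSpace ℝ E] [CompleteSpace E]

/-- The weight is frozen at time a, so Doob's inequality has no error term (D = 0) and orthogonality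
turns the squared increment into a difference of squares exactly. -/
theorem integral_weight_mul_incrMax_sq_le {ℱ : Filtration ℕ mX} [SigmaFiniteFiltration μ ℱ]
    {f : ℕ → X → E} (hf : Martingale f ℱ μ) {a b : ℕ} (hab : a ≤ b) {W : X → ℝ}
    (hW : StronglyMeasurable[ℱ a] W) (hW0 : ∀ x, 0 ≤ W x)
    (hint : ∀ n, a ≤ n → Integrable (fun x => W x * runningMax f n x ^ 2) μ) :
    ∫ x, W x * incrMax f a (b - a) x ^ 2 ∂μ ≤
      4 * (∫ x, W x * ‖f b x‖ ^ 2 ∂μ - ∫ x, W x * ‖f a x‖ ^ 2 ∂μ) := by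
  have he : Monotone (fun k : ℕ => a + k) := fun _ _ h => Nat.add_le_add_left h a
  have := sigmaFiniteFiltration_reindex (μ := μ) ℱ _ he
  have hW' : StronglyMeasurable W := hW.mono (ℱ.le a)
  have hfm : ∀ n, StronglyMeasurable (f n) := fun n => (hf.1 n).mono (ℱ.le n)
  have hY0 := runningMax_nonneg f
  have hM0 := incrMax_nonneg f a
  have hM2 := incrMax_le f a
  have dom : ∀ n, a ≤ n → ∀ (g : X → ℝ), StronglyMeasurable g → (∀ x, 0 ≤ g x) →
      (∀ x, g x ≤ 4 * runningMax f n x ^ 2) → Integrable (fun x => W x * g x) μ := by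
    intro n hn g hg hg0 hgle
    refine ((hint n hn).const_mul 4).mono' (hW'.mul hg).aestronglyMeasurable
      (Filter.Eventually.of_forall fun x => ?_)
    rw [Real.norm_of_nonneg (mul_nonneg (hW0 x) (hg0 x))]
    have := mul_le_mul_of_nonneg_left (hgle x) (hW0 x)
    linarith
  obtain ⟨-, -, hD⟩ := integral_weight_mul_runningMax_sq_le (martingale_increment hf a)
    (w := fun _ => W) (D := fun _ _ => 0)
    (fun k => hW.mono (ℱ.mono (Nat.le_add_right a k))) (fun _ x => hW0 x)
    (fun k x => by simp) (fun k x => by simp) (fun _ => integrable_zero _ _ _)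
    (fun k => by
      refine dom (a + (k + 1)) (by omega) (fun x => incrMax f a k x * incrMax f a (k + 1) x)
        (((stronglyMeasurable_incrMax hf.1 a k).mono (ℱ.le _)).mul
          ((stronglyMeasurable_incrMax hf.1 a (k + 1)).mono (ℱ.le _)))
        (fun x => mul_nonneg (hM0 _ _) (hM0 _ _)) fun x => ?_
      have h1 := hM2 k x
      have h2 := hM2 (k + 1) x
      have h3 : runningMax f (a + k) x ≤ runningMax f (a + (k + 1)) x :=
        runningMax_mono f x (by omega)
      have h4 : incrMax f a k x ≤ 2 * runningMax f (a + (k + 1)) x := by linarith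
      have := mul_le_mul h4 h2 (hM0 _ _) ((hM0 _ _).trans h4)
      linarith) (b - a)
  simp only [integral_zero, sub_self, mul_zero, zero_add, Nat.add_sub_cancel' hab] at hD
  change ∫ x, W x * incrMax f a (b - a) x ^ 2 ∂μ ≤ _ at hD
  have hfi : ∀ n, a ≤ n → Integrable (fun x => W x * ‖f n x‖ ^ 2) μ := fun n hn =>
    dom n hn _ ((hfm n).norm.pow 2) (fun x => sq_nonneg _) fun x => by
      have := norm_le_runningMax f n x
      have := norm_nonneg (f n x)
      nlinarith
  have hψ : StronglyMeasurable[ℱ a] (fun x => W x • f a x) := hW.smul (hf.1 a)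
  have horth : Integrable (fun x => inner ℝ (W x • f a x) (f b x - f a x)) μ := by
    refine ((hint b hab).const_mul 2).mono' ?_ (Filter.Eventually.of_forall fun x => ?_)
    · exact (hψ.mono (ℱ.le a)).aestronglyMeasurable.inner
        ((hfm b).sub (hfm a)).aestronglyMeasurable
    · refine (norm_inner_le_norm _ _).trans ?_
      rw [norm_smul, Real.norm_of_nonneg (hW0 x), mul_assoc]
      have h1 := norm_le_runningMax_of_le f hab x
      have h2 := norm_sub_le_two_mul_runningMax f hab le_rfl x
      have h3 := mul_le_mul h1 h2 (norm_nonneg _) (hY0 b x)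
      have := mul_le_mul_of_nonneg_left h3 (hW0 x)
      linarith
  have hzero := integral_inner_martingale_sub hf hab hψ horth
  have j1 : Integrable (fun x => W x * ‖f b x‖ ^ 2 - W x * ‖f a x‖ ^ 2) μ :=
    (hfi b hab).sub (hfi a le_rfl)
  have hA : ∫ x, W x * ‖f b x - f a x‖ ^ 2 ∂μ =
      ∫ x, (W x * ‖f b x‖ ^ 2 - W x * ‖f a x‖ ^ 2
        - 2 * inner ℝ (W x • f a x) (f b x - f a x)) ∂μ := by
    congr 1
    ext x
    rw [@norm_sub_sq_real, real_inner_smul_left, inner_sub_right, real_inner_self_eq_norm_sq,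
      real_inner_comm]
    ring
  rw [integral_sub j1 (horth.const_mul 2), integral_sub (hfi b hab) (hfi a le_rfl),
    integral_const_mul, hzero, mul_zero, sub_zero] at hA
  rw [← hA]
  exact hD

/-- Summation by parts: the negative term of each block cancels the bound inherited from the
previous blocks, and raising the weight from O_n^(q-1) to O_(n+1)^(q-1) only increases the right
side. -/
theorem sum_integral_oscSq_rpow_mul_le {ℱ : Filtration ℕ mX} [SigmaFiniteFiltration μ ℱ]
    {f : ℕ → X → E} (hf : Martingale f ℱ μ) {q : ℝ} (hq : 1 ≤ q)
    (hfp : ∀ n, Integrable (fun x => ‖f n x‖ ^ (2 * q)) μ) {J : ℕ → ℕ} (hJ : Monotone J) (n : ℕ) :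
    ∑ j ∈ Finset.range n,
      ∫ x, oscSq f J j x ^ (q - 1) * incrMax f (J j) (J (j + 1) - J j) x ^ 2 ∂μ ≤
      4 * ∫ x, oscSq f J n x ^ (q - 1) * ‖f (J n) x‖ ^ 2 ∂μ := by
  have hA := oscSq_nonneg f J
  induction n with
  | zero =>
    simp only [Finset.range_zero, Finset.sum_empty]
    refine mul_nonneg (by norm_num) (integral_nonneg fun x => ?_)
    exact mul_nonneg (Real.rpow_nonneg (hA _ _) _) (sq_nonneg _)
  | succ n ih =>
    rw [Finset.sum_range_succ]
    have h1 := integral_weight_mul_incrMax_sq_le hf (hJ n.le_succ)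
      (W := fun x => oscSq f J n x ^ (q - 1))
      ((stronglyMeasurable_oscSq hf.1 hJ n).measurable.pow_const (q - 1)).stronglyMeasurable
      (fun x => Real.rpow_nonneg (hA _ _) _)
      (fun m hm => integrable_oscSq_rpow_mul_sq hf.1 hq hfp hJ hm (c := 1)
        ((stronglyMeasurable_runningMax hf.1 m).mono (ℱ.le m)) fun x => by
          rw [abs_of_nonneg (runningMax_nonneg f m x), one_mul])
    have h2 : ∫ x, oscSq f J n x ^ (q - 1) * ‖f (J (n + 1)) x‖ ^ 2 ∂μ ≤
        ∫ x, oscSq f J (n + 1) x ^ (q - 1) * ‖f (J (n + 1)) x‖ ^ 2 ∂μ := by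
      have hi : ∀ j, J j ≤ J (n + 1) →
          Integrable (fun x => oscSq f J j x ^ (q - 1) * ‖f (J (n + 1)) x‖ ^ 2) μ := fun j hj =>
        integrable_oscSq_rpow_mul_sq hf.1 hq hfp hJ hj (c := 1)
          ((hf.1 (J (n + 1))).mono (ℱ.le _)).norm fun x => by
            rw [abs_norm, one_mul]; exact norm_le_runningMax f _ x
      refine integral_mono (hi n (hJ n.le_succ)) (hi (n + 1) le_rfl) fun x => ?_
      refine mul_le_mul_of_nonneg_right ?_ (sq_nonneg _)
      refine Real.rpow_le_rpow (hA n x) ?_ (by linarith)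
      rw [oscSq_succ]
      linarith [sq_nonneg (incrMax f (J n) (J (n + 1) - J n) x)]
    simp only [Nat.succ_eq_add_one] at h1
    linarith

end GtTwo

theorem exists_integral_oscSq_rpow_le_of_two_lt {p : ℝ} (hp : 2 < p) :
    ∃ C : ℝ, 0 ≤ C ∧ ∀ {X : Type u} {E : Type v} {mX : MeasurableSpace X} {μ : Measure X}
      [NormedAddCommGroup E] [InnerProductSpace ℝ E] [CompleteSpace E]
      {ℱ : Filtration ℕ mX} [SigmaFiniteFiltration μ ℱ] {f : ℕ → X → E},
      Martingale f ℱ μ → (∀ n, Integrable (fun x => ‖f n x‖ ^ p) μ) →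
      ∀ {J : ℕ → ℕ}, Monotone J → ∀ N,
      ∫ x, oscSq f J N x ^ (p / 2) ∂μ ≤ C * ∫ x, runningMax f (J N) x ^ p ∂μ := by
  obtain ⟨q, rfl⟩ : ∃ q, p = 2 * q := ⟨p / 2, by ring⟩
  have hq : 1 < q := by linarith
  have e2 : 2 * q / 2 = q := by ring
  set K := q * 2 ^ (q - 1) with hK
  have hKpos : 0 < K := by positivity
  -- The two values of ε make each Young inequality cost a quarter of ∫ O^q (the first is multiplied
  -- by 4K, the second by K). Half remains on the left, hence the leading 2 in the constant.
  obtain ⟨K₁, hK₁, h₁⟩ := exists_rpow_mul_rpow_le (r := q - 1) (s := 1) (ε := 1 / (16 * K))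
    (by linarith) one_pos (by positivity)
  obtain ⟨K₂, hK₂, h₂⟩ := exists_rpow_mul_rpow_le (r := 1) (s := q - 1) (ε := 1 / (4 * K))
    zero_le_one (by linarith) (by positivity)
  refine ⟨2 * (4 * K * K₁ + K * K₂ * 4 ^ q), by positivity, ?_⟩
  intro X E mX μ _ _ _ ℱ _ f hf hfp J hJ N
  have hA := oscSq_nonneg f J
  have hY0 := runningMax_nonneg f
  have hYi := integrable_runningMax_rpow hf.1 hfp (J N)
  have hAi := integrable_oscSq_rpow hf.1 hJ (by linarith) hfp N
  rw [e2] at hAi ⊢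
  have hYq : ∀ x, (runningMax f (J N) x ^ 2) ^ q = runningMax f (J N) x ^ (2 * q) := fun x => by
    rw [← sq_rpow_half (hY0 (J N) x), e2]
  have hBi : ∀ j, Integrable
      (fun x => oscSq f J j x ^ (q - 1) * incrMax f (J j) (J (j + 1) - J j) x ^ 2) μ := fun j =>
    integrable_oscSq_rpow_mul_sq hf.1 hq.le hfp hJ (hJ j.le_succ) (c := 2)
      ((stronglyMeasurable_incrMax_block hf.1 hJ j).mono (ℱ.le _)) fun x => by
        rw [abs_of_nonneg (incrMax_nonneg _ _ _ _)]
        exact incrMax_block_le f hJ j.lt_succ_self x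
  have hsum := sum_integral_oscSq_rpow_mul_le hf hq.le hfp hJ N
  rw [← integral_finsetSum _ fun j _ => hBi j] at hsum
  have hsi := integrable_finsetSum (Finset.range N) fun j _ => hBi j
  have hfi : Integrable (fun x => oscSq f J N x ^ (q - 1) * ‖f (J N) x‖ ^ 2) μ :=
    integrable_oscSq_rpow_mul_sq hf.1 hq.le hfp hJ le_rfl (c := 1)
      ((hf.1 (J N)).mono (ℱ.le _)).norm fun x => by
        rw [abs_norm, one_mul]; exact norm_le_runningMax f _ x
  have hpt : ∀ x, oscSq f J N x ^ q ≤
      K * (∑ j ∈ Finset.range N,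
        oscSq f J j x ^ (q - 1) * incrMax f (J j) (J (j + 1) - J j) x ^ 2)
      + (1 / 4 * oscSq f J N x ^ q + K * K₂ * 4 ^ q * runningMax f (J N) x ^ (2 * q)) := by
    intro x
    have h := oscSq_rpow_le f hJ hq (le_refl N) x
    have h' := h₂ (oscSq f J N x) (4 * runningMax f (J N) x ^ 2) (hA N x) (by positivity)
    rw [show 1 + (q - 1) = q by ring, Real.rpow_one, Real.mul_rpow (z := q) (by norm_num)
      (sq_nonneg _), hYq] at h'
    have h'' := mul_le_mul_of_nonneg_left h' hKpos.le
    have e : K * (1 / (4 * K) * oscSq f J N x ^ q + K₂ * (4 ^ q * runningMax f (J N) x ^ (2 * q)))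
        = 1 / 4 * oscSq f J N x ^ q + K * K₂ * 4 ^ q * runningMax f (J N) x ^ (2 * q) := by
      field_simp
    rw [e] at h''
    rw [← hK] at h
    linarith
  have hpt2 : ∀ x, oscSq f J N x ^ (q - 1) * ‖f (J N) x‖ ^ 2 ≤
      1 / (16 * K) * oscSq f J N x ^ q + K₁ * runningMax f (J N) x ^ (2 * q) := by
    intro x
    have h := h₁ (oscSq f J N x) (runningMax f (J N) x ^ 2) (hA N x) (sq_nonneg _)
    rw [sub_add_cancel, Real.rpow_one, hYq] at h
    refine le_trans ?_ h
    have := norm_le_runningMax f (J N) x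
    have := Real.rpow_nonneg (hA N x) (q - 1)
    gcongr
  have hI1 := integral_mono hAi
    ((hsi.const_mul K).add ((hAi.const_mul (1 / 4)).add (hYi.const_mul (K * K₂ * 4 ^ q)))) hpt
  rw [integral_add' (hsi.const_mul K) ((hAi.const_mul (1 / 4)).add (hYi.const_mul _)),
    integral_add' (hAi.const_mul (1 / 4)) (hYi.const_mul _), integral_const_mul,
    integral_const_mul, integral_const_mul] at hI1
  have hI2 := integral_mono hfi ((hAi.const_mul (1 / (16 * K))).add (hYi.const_mul K₁)) hpt2
  rw [integral_add' (hAi.const_mul _) (hYi.const_mul _), integral_const_mul,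
    integral_const_mul] at hI2
  set IA := ∫ x, oscSq f J N x ^ q ∂μ
  set IY := ∫ x, runningMax f (J N) x ^ (2 * q) ∂μ
  have h3 := mul_le_mul_of_nonneg_left (hsum.trans (mul_le_mul_of_nonneg_left hI2 zero_le_four))
    hKpos.le
  have e3 : K * (4 * (1 / (16 * K) * IA + K₁ * IY)) = 1 / 4 * IA + 4 * K * K₁ * IY := by
    field_simp
    ring
  rw [e3] at h3
  linarith

/-- The oscillation inequality for martingales indexed by `ℕ`. -/
theorem exists_integral_oscSq_rpow_le {p : ℝ} (hp : 1 < p) :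
    ∃ C : ℝ, 0 ≤ C ∧ ∀ {X : Type u} {E : Type v} {mX : MeasurableSpace X} {μ : Measure X}
      [NormedAddCommGroup E] [InnerProductSpace ℝ E] [CompleteSpace E]
      {ℱ : Filtration ℕ mX} [SigmaFiniteFiltration μ ℱ] {f : ℕ → X → E},
      Martingale f ℱ μ → (∀ n, Integrable (fun x => ‖f n x‖ ^ p) μ) →
      ∀ {J : ℕ → ℕ}, Monotone J → ∀ N,
      ∫ x, oscSq f J N x ^ (p / 2) ∂μ ≤ C * ∫ x, ‖f (J N) x‖ ^ p ∂μ := by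
  obtain ⟨C, hC, hDoob⟩ := exists_integral_runningMax_rpow_le.{u, v} hp
  rcases le_or_gt p 2 with hp2 | hp2
  · refine ⟨41 * C, by positivity, ?_⟩
    intro X E mX μ _ _ _ ℱ _ f hf hfp J hJ N
    have h1 := integral_oscSq_rpow_le_of_le_two hf hp hp2 hfp hJ N
    have h2 := hDoob hf hfp (J N)
    linarith
  · obtain ⟨K, hK, hosc⟩ := exists_integral_oscSq_rpow_le_of_two_lt.{u, v} hp2
    refine ⟨K * C, by positivity, ?_⟩
    intro X E mX μ _ _ _ ℱ _ f hf hfp J hJ N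
    have h1 := hosc hf hfp hJ N
    have h2 := mul_le_mul_of_nonneg_left (hDoob hf hfp (J N)) hK
    linarith

/-! ### Transfer from ℤ to ℕ and conclusion -/

/-- The times of `I` measured from `I 0`, extended by a constant after the last one. -/
def relativeTimes {N : ℕ} (I : Fin (N + 1) → ℤ) (j : ℕ) : ℕ :=
  (I ⟨min j N, by omega⟩ - I 0).toNat

theorem relativeTimes_spec {N : ℕ} {I : Fin (N + 1) → ℤ} (hI : StrictMono I) {j : ℕ}
    (hj : j < N + 1) : I 0 + (relativeTimes I j : ℤ) = I ⟨j, hj⟩ := by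
  have e : (⟨min j N, by omega⟩ : Fin (N + 1)) = ⟨j, hj⟩ := Fin.ext (min_eq_left (by omega))
  have h : I 0 ≤ I ⟨j, hj⟩ := hI.monotone (Fin.zero_le _)
  rw [relativeTimes, e]
  omega

theorem relativeTimes_mono {N : ℕ} {I : Fin (N + 1) → ℤ} (hI : StrictMono I) :
    Monotone (relativeTimes I) := by
  intro i j hij
  refine Int.toNat_le_toNat (sub_le_sub_right (hI.monotone ?_) _)
  exact Fin.mk_le_mk.2 (min_le_min_right N hij)

theorem seqOscillation_rpow_le {X : Type*} (f : ℤ → X → ℂ) {N : ℕ} {I : Fin (N + 1) → ℤ}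
    (hI : StrictMono I) {r : ℝ} (hr : 0 ≤ r) (x : X) :
    seqOscillation 2 I (fun n => f n x) ^ r ≤
      ENNReal.ofReal (oscSq (fun (k : ℕ) => f (I 0 + k)) (relativeTimes I) N x ^ (r / 2)) := by
  set g : ℕ → X → ℂ := fun k => f (I 0 + k) with hg
  set J := relativeTimes I
  -- The supremum runs over a half-open block, while `incrMax` also includes the right endpoint;
  -- only the upper bound is needed.
  have hterm : ∀ j : Fin N, (⨆ t ∈ Set.Ico (I j.castSucc) (I j.succ),
      ‖f t x - f (I j.castSucc) x‖ₑ ^ (2 : ℝ)) ≤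
      ENNReal.ofReal (incrMax g (J j) (J (j + 1) - J j) x ^ 2) := by
    intro j
    refine iSup₂_le fun t ht => ?_
    have e1 : I 0 + (J j : ℤ) = I j.castSucc := relativeTimes_spec hI (by omega)
    have e2 : I 0 + (J (j + 1) : ℤ) = I j.succ := relativeTimes_spec hI (by omega)
    obtain ⟨i, hi⟩ : ∃ i : ℕ, t = I 0 + ((J j + i : ℕ) : ℤ) :=
      ⟨(t - I j.castSucc).toNat, by have := ht.1; push_cast; omega⟩
    have hle : i ≤ J (j + 1) - J j := by
      have := ht.2
      push_cast at hi
      omega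
    have h := norm_le_runningMax_of_le (fun i x => g (J j + i) x - g (J j) x) hle x
    have h' : ‖f t x - f (I j.castSucc) x‖ ≤ incrMax g (J j) (J (j + 1) - J j) x := by
      rw [hi, ← e1]
      exact h
    rw [← ofReal_norm, ENNReal.ofReal_rpow_of_nonneg (norm_nonneg _) zero_le_two]
    refine ENNReal.ofReal_le_ofReal ?_
    rw [Real.rpow_two]
    exact pow_le_pow_left₀ (norm_nonneg _) h' 2
  have hsum : ∑ j : Fin N, (⨆ t ∈ Set.Ico (I j.castSucc) (I j.succ),
      ‖f t x - f (I j.castSucc) x‖ₑ ^ (2 : ℝ)) ≤ ENNReal.ofReal (oscSq g J N x) := by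
    rw [oscSq, Finset.sum_range, ENNReal.ofReal_sum_of_nonneg fun _ _ => sq_nonneg _]
    exact Finset.sum_le_sum fun j _ => hterm j
  rw [seqOscillation, ← ENNReal.rpow_mul,
    ← ENNReal.ofReal_rpow_of_nonneg (oscSq_nonneg _ _ _ _) (by positivity),
    show 1 / 2 * r = r / 2 by ring]
  exact ENNReal.rpow_le_rpow hsum (by positivity)

theorem proposition2p1 (p : ℝ≥0∞) (hp : 1 < p) (hp' : p < ∞) :
    ∃ C : ℝ≥0, 0 < C ∧
      ∀ {X : Type*} [mX : MeasurableSpace X] (μ : Measure X) [SigmaFinite μ]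
        (ℱ : Filtration ℤ mX) [SigmaFiniteFiltration μ ℱ] (f : ℤ → X → ℂ),
        Martingale f ℱ μ →
        (∀ n, MemLp (f n) p μ) →
        (⨆ n, eLpNorm (f n) p μ) < ∞ →
        (⨆ (N : ℕ) (_ : 1 ≤ N) (I ∈ strictIncSeqs N ℤ),
            eLpNorm (fun x => seqOscillation 2 I (fun n => f n x)) p μ) ≤
          C * ⨆ n, eLpNorm (f n) p μ := by
  have hp0 : p ≠ 0 := (zero_lt_one.trans hp).ne'
  have hr : 1 < p.toReal := by
    rw [← ENNReal.toReal_one]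
    exact (ENNReal.toReal_lt_toReal ENNReal.one_ne_top hp'.ne).2 hp
  set r := p.toReal with hr_def
  obtain ⟨C, hC, hosc⟩ := exists_integral_oscSq_rpow_le hr
  -- Adding 1 makes the constant positive even if C = 0; the root undoes the r-th powers in the
  -- integral inequality.
  refine ⟨(C.toNNReal + 1) ^ (1 / r), NNReal.rpow_pos (by positivity), ?_⟩
  intro X mX μ _ ℱ _ f hf hfp _
  refine iSup_le fun N => iSup_le fun _ => iSup₂_le fun I hI => ?_
  have hI : StrictMono I := hI
  have he : Monotone (fun k : ℕ => I 0 + (k : ℤ)) := fun _ _ h => by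
    simpa using h
  have := sigmaFiniteFiltration_reindex (μ := μ) ℱ _ he
  have hg := martingale_reindex hf _ he
  have hgp : ∀ k : ℕ, Integrable (fun x => ‖f (I 0 + k) x‖ ^ r) μ := fun k =>
    (hfp (I 0 + k)).integrable_norm_rpow hp0 hp'.ne
  have hJ := relativeTimes_mono hI
  have hmain := hosc hg hgp hJ N
  have hint := integrable_oscSq_rpow hg.1 hJ (by linarith) hgp N
  -- The supremum of norms is needed only at the last time of I.
  refine le_trans ?_ (mul_le_mul_right (le_iSup (fun n => eLpNorm (f n) p μ)
    (I 0 + (relativeTimes I N : ℤ))) _)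
  rw [eLpNorm_eq_lintegral_rpow_enorm_toReal hp0 hp'.ne,
    eLpNorm_eq_lintegral_rpow_enorm_toReal hp0 hp'.ne, ← hr_def,
    ENNReal.coe_rpow_of_nonneg _ (by positivity),
    ← ENNReal.mul_rpow_of_nonneg _ _ (by positivity)]
  refine ENNReal.rpow_le_rpow ?_ (by positivity)
  calc ∫⁻ x, ‖seqOscillation 2 I (fun n => f n x)‖ₑ ^ r ∂μ
      ≤ ∫⁻ x, ENNReal.ofReal
          (oscSq (fun (k : ℕ) => f (I 0 + k)) (relativeTimes I) N x ^ (r / 2)) ∂μ :=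
        lintegral_mono fun x => seqOscillation_rpow_le f hI (by linarith) x
    _ = ENNReal.ofReal (∫ x,
          oscSq (fun (k : ℕ) => f (I 0 + k)) (relativeTimes I) N x ^ (r / 2) ∂μ) :=
        (ofReal_integral_eq_lintegral_ofReal hint (Filter.Eventually.of_forall fun x =>
          Real.rpow_nonneg (oscSq_nonneg _ _ _ _) _)).symm
    _ ≤ ENNReal.ofReal (C * ∫ x, ‖f (I 0 + (relativeTimes I N : ℤ)) x‖ ^ r ∂μ) :=
        ENNReal.ofReal_le_ofReal hmain
    _ = ENNReal.ofReal C * ∫⁻ x, ‖f (I 0 + (relativeTimes I N : ℤ)) x‖ₑ ^ r ∂μ := by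
        rw [ENNReal.ofReal_mul hC, ofReal_integral_eq_lintegral_ofReal (hgp _)
          (Filter.Eventually.of_forall fun x => Real.rpow_nonneg (norm_nonneg _) _)]
        congr 2
        ext x
        rw [← ENNReal.ofReal_rpow_of_nonneg (norm_nonneg _) (by linarith), ofReal_norm]
    _ ≤ _ := by
        gcongr
        rw [ENNReal.ofReal]
        exact_mod_cast le_self_add
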